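/- Let $\mathbb T=\mathbb R/2\pi\mathbb Z$, equipped with the normalized Lebesgue measure, write $\langle n\rangle=(1+n^2)^{1/2}$, and for $\alpha\in\mathbb R$ let $\mathcal H^\alpha=H^\alpha(\mathbb T)\times H^{\alpha-1}(\mathbb T)$ (real-valued distributions) with norm $$\|(u,v)\|_{\mathcal H^\alpha}^2=\sum_{n\in\mathbb Z}\langle n\rangle^{2\alpha}|\widehat u(n)|^2+\sum_{n\in\mathbb Z}\langle n\rangle^{2(\alpha-1)}|\widehat v(n)|^2 .$$ Let $\gamma,\beta\in\mathbb R\setminus\{0\}$ and $0<\varepsilon<\frac12$, and consider the stochastic damped sine-Gordon equation $$\partial_t^2u+\partial_tu+(1-\partial_x^2)u+\gamma\sin(\beta u)=\sqrt2\,\xi,\qquad (u,\partial_tu)|_{t=0}=\mathbf u_0=(u_0,v_0),\qquad (t,x)\in\mathbb R_+\times\mathbb T,$$ where $\xi$ is space-time white noise, i.e. $\xi=\partial_tW$ with $W(t)=\sum_{n\in\mathbb Z}B_n(t)e^{inx}$, $B_{-n}=\overline{B_n}$, $B_0$ a standard real Brownian motion, and $B_n$ ($n\ge1$) complex Brownian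 motions with independent real and imaginary parts and $\mathbb E|B_n(t)|^2=t$, all mutually independent. For $\mathbf u_0\in\mathcal H^{\frac12-\varepsilon}$ let $\vec\Phi_t(\mathbf u_0,\xi)=(u(t),\partial_tu(t))$, $t\ge0$, be the solution with almost surely continuous paths in $\mathcal H^{\frac12-\varepsilon}$. Then there exist constants $\lambda_0,\kappa,C,K>0$, depending only on $\gamma,\beta,\varepsilon$, such that for every $0<\lambda\le\lambda_0$, every $\mathbf u_0\in\mathcal H^{\frac12-\varepsilon}$ and every $t\ge0$, the random variable $\exp\big(\lambda\|\vec\Phi_t(\mathbf u_0,\xi)\|_{\mathcal H^{\frac12-\varepsilon}}^2\big)$ is integrable and $$\mathbb E\Big[\exp\big(\lambda\|\vec\Phi_t(\mathbf u_0,\xi)\|_{\mathcal H^{\frac12-\varepsilon}}^2\big)\Big]\le C\,e^{-\kappa t}\exp\big(\lambda\|\mathbf u_0\|_{\mathcal H^{\frac12-\varepsilon}}^2\big)+K .$$ -/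

import Mathlib

open MeasureTheory ProbabilityTheory
open scoped NNReal ENNReal

namespace SineGordon

noncomputable section

instance factTwoPiPos : Fact (0 < 2 * Real.pi) := ⟨Real.two_pi_pos⟩

/-- The torus `𝕋 = ℝ / 2πℤ`.  It is always given the normalized Lebesgue measure
`dx / 2π`, which is `AddCircle.haarAddCircle`. -/
abbrev Torus : Type := AddCircle (2 * Real.pi)

/-- The Japanese bracket `⟨n⟩ = (1 + n²)^{1/2}`. -/
def bracket (n : ℤ) : ℝ := Real.sqrt (1 + (n : ℝ) ^ 2)

lemma bracket_pos (n : ℤ) : 0 < bracket n := Real.sqrt_pos.2 (by positivity)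

/-! ### Sobolev spaces of real-valued distributions on the torus -/

/-- The sequence `n ↦ ⟨n⟩^s a(n)`. -/
def weighted (s : ℝ) : (ℤ → ℂ) →ₗ[ℝ] (ℤ → ℂ) where
  toFun a n := (bracket n ^ s) • a n
  map_add' a b := by funext n; simp
  map_smul' c a := by funext n; exact smul_comm (bracket n ^ s) c (a n)

/-- Fourier coefficient sequences of the real-valued distributions in `H^s(𝕋)`:
`a(-n)` is the complex conjugate of `a(n)`, and `∑ₙ ⟨n⟩^{2s} |a(n)|² < ∞`. -/
def sobolevSubmodule (s : ℝ) : Submodule ℝ (ℤ → ℂ) where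
  carrier := {a | (∀ n, a (-n) = star (a n)) ∧ Memℓp (weighted s a) 2}
  zero_mem' := ⟨fun n => by simp, by rw [map_zero]; exact zero_memℓp⟩
  add_mem' := fun {a b} ha hb =>
    ⟨fun n => by simp [ha.1 n, hb.1 n], by rw [map_add]; exact ha.2.add hb.2⟩
  smul_mem' := fun c a ha =>
    ⟨fun n => by simp [ha.1 n], by rw [map_smul]; exact ha.2.const_smul c⟩

/-- The real Sobolev space `H^s(𝕋)`, `s ∈ ℝ`: a real-valued periodic distribution is identified
with the sequence of its Fourier coefficients. -/
def Sobolev (s : ℝ) : Type := sobolevSubmodule s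

namespace Sobolev

instance (s : ℝ) : AddCommGroup (Sobolev s) := inferInstanceAs (AddCommGroup (sobolevSubmodule s))

instance (s : ℝ) : Module ℝ (Sobolev s) := inferInstanceAs (Module ℝ (sobolevSubmodule s))

/-- The `n`-th Fourier coefficient of an element of `H^s(𝕋)`. -/
def coeff {s : ℝ} (a : Sobolev s) (n : ℤ) : ℂ := a.1 n

/-- The map `a ↦ (⟨n⟩^s a(n))ₙ` from `H^s(𝕋)` to `ℓ²(ℤ)`. -/
def toEll2 (s : ℝ) : Sobolev s →ₗ[ℝ] lp (fun _ : ℤ => ℂ) 2 where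
  toFun a := ⟨weighted s a.1, a.2.2⟩
  map_add' a b := Subtype.ext ((weighted s).map_add a.1 b.1)
  map_smul' c a := Subtype.ext ((weighted s).map_smul c a.1)

lemma toEll2_injective (s : ℝ) : Function.Injective (toEll2 s) := by
  intro a b h
  refine Subtype.ext (funext fun n => ?_)
  have h1 : (bracket n ^ s) • a.1 n = (bracket n ^ s) • b.1 n :=
    congrFun (congrArg Subtype.val h) n
  exact smul_right_injective ℂ (Real.rpow_pos_of_pos (bracket_pos n) s).ne' h1

/-- The Sobolev norm `‖a‖_{H^s} = (∑ₙ ⟨n⟩^{2s} |a(n)|²)^{1/2}`, as the norm of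
`(⟨n⟩^s a(n))ₙ` in `ℓ²(ℤ)`. -/
instance (s : ℝ) : NormedAddCommGroup (Sobolev s) :=
  NormedAddCommGroup.induced (Sobolev s) (lp (fun _ : ℤ => ℂ) 2) (toEll2 s) (toEll2_injective s)

lemma norm_sq_eq {s : ℝ} (a : Sobolev s) :
    ‖a‖ ^ 2 = ∑' n : ℤ, bracket n ^ (2 * s) * ‖a.coeff n‖ ^ 2 := by
  have h := lp.norm_rpow_eq_tsum (p := 2) (by norm_num) (toEll2 s a)
  have h' : ‖a‖ ^ 2 = ‖toEll2 s a‖ ^ (2 : ℝ≥0∞).toReal := by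
    simp only [ENNReal.toReal_ofNat, Real.rpow_ofNat]
    rfl
  rw [h', h]
  refine tsum_congr fun n => ?_
  have h2 : (toEll2 s a) n = (bracket n ^ s) • a.coeff n := rfl
  rw [h2, norm_smul, Real.norm_of_nonneg (Real.rpow_nonneg (bracket_pos n).le s),
    ENNReal.toReal_ofNat, Real.rpow_ofNat, mul_pow, ← Real.rpow_natCast,
    ← Real.rpow_mul (bracket_pos n).le]
  norm_num [mul_comm]

end Sobolev

/-- The phase space `𝓗^α(𝕋) = H^α(𝕋) × H^{α-1}(𝕋)` with the norm
`‖(u, v)‖² = ‖u‖²_{H^α} + ‖v‖²_{H^{α-1}}`. -/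
abbrev PhaseSpace (α : ℝ) : Type := WithLp 2 (Sobolev α × Sobolev (α - 1))

/-! ### The nonlinearity -/

/-- The function in `L²(𝕋)` with Fourier coefficients `a`, that is `∑ₙ a(n) e^{inx}`
(the series converges in `L²` whenever `a` is square summable). -/
def toL2 (a : ℤ → ℂ) : Lp ℂ 2 (AddCircle.haarAddCircle : Measure Torus) :=
  ∑' n : ℤ, a n • fourierLp 2 n

/-- The `n`-th Fourier coefficient of the function `x ↦ sin (β u(x))`, where `u` is the (real)
function with Fourier coefficients `a`. -/
def sinCoeff (β : ℝ) (a : ℤ → ℂ) (n : ℤ) : ℂ :=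
  fourierCoeff (fun x : Torus => ((Real.sin (β * (toL2 a x).re) : ℝ) : ℂ)) n

/-! ### The noise -/

/-- `W` is a sequence of mutually independent standard real Brownian motions: the coordinates of a
cylindrical Wiener process on the real Hilbert space `L²(𝕋)` in the orthonormal basis
`1`, `√2 cos (n x)`, `-√2 sin (n x)` (`n ≥ 1`), with indices `0`, `n`, `-n` respectively. -/
structure IsCylindricalWiener {Ω : Type*} [MeasurableSpace Ω] (P : Measure Ω)
    (W : ℤ → ℝ≥0 → Ω → ℝ) : Prop where
  brownian : ∀ n, IsBrownianReal (W n) P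
  indep : iIndepFun (fun n ω t => W n t ω) P

/-- The Fourier modes `Bₙ` of the cylindrical Wiener process `∑ₙ Bₙ(t) e^{inx}`: `B₀` is a standard
real Brownian motion, `Bₙ` (`n ≥ 1`) are independent complex Brownian motions with
`𝔼|Bₙ(t)|² = t`, and `B₋ₙ` is the complex conjugate of `Bₙ`. -/
def noiseMode {Ω : Type*} (W : ℤ → ℝ≥0 → Ω → ℝ) (n : ℤ) (t : ℝ≥0) (ω : Ω) : ℂ :=
  if n = 0 then (W 0 t ω : ℂ)
  else if 0 < n then ((W n t ω : ℂ) + Complex.I * (W (-n) t ω : ℂ)) / (Real.sqrt 2 : ℂ)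
  else ((W (-n) t ω : ℂ) - Complex.I * (W n t ω : ℂ)) / (Real.sqrt 2 : ℂ)

/-! ### The equation -/

/-- `Φ(t) = (u(t), ∂ₜu(t))`, `t ≥ 0`, is the solution with values in `𝓗^α(𝕋)` and initial state
`u₀` of the stochastic damped sine-Gordon equation
`∂ₜ²u + ∂ₜu + (1 - ∂ₓ²)u + γ sin(βu) = √2 ξ`, where `ξ` is the space-time white noise with
`ξ = ∂ₜ ∑ₙ Bₙ(t) e^{inx}`.  With `v = ∂ₜu` the equation reads
`du = v dt`, `dv = (-(1 - ∂ₓ²)u - v - γ sin(βu)) dt + √2 dW`; almost surely, it holds in integrated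
form on every Fourier mode (i.e. tested against every `e^{inx}`), and the paths are continuous in
`𝓗^α(𝕋)`. -/
structure IsSolution {Ω : Type*} [MeasurableSpace Ω] (P : Measure Ω) (W : ℤ → ℝ≥0 → Ω → ℝ)
    (γ β : ℝ) {α : ℝ} (u₀ : PhaseSpace α) (Φ : ℝ≥0 → Ω → PhaseSpace α) : Prop where
  measurable : ∀ t, AEStronglyMeasurable (Φ t) P
  continuous_paths : ∀ᵐ ω ∂P, Continuous fun t => Φ t ω
  position : ∀ᵐ ω ∂P, ∀ (n : ℤ) (t : ℝ≥0),
    (Φ t ω).fst.coeff n = u₀.fst.coeff n + ∫ s in (0 : ℝ)..t, (Φ s.toNNReal ω).snd.coeff n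
  momentum : ∀ᵐ ω ∂P, ∀ (n : ℤ) (t : ℝ≥0),
    (Φ t ω).snd.coeff n = u₀.snd.coeff n
      + (∫ s in (0 : ℝ)..t,
          (-(1 + (n : ℂ) ^ 2) * (Φ s.toNNReal ω).fst.coeff n
            - (Φ s.toNNReal ω).snd.coeff n
            - (γ : ℂ) * sinCoeff β (Φ s.toNNReal ω).fst.coeff n))
      + (Real.sqrt 2 : ℂ) * noiseMode W n t ω

end

end SineGordon

/-! ### Wiener integrals of deterministic functions and their exponential moments. -/

namespace SineGordon

open Filter Topology Finset

/-! Fourier modes are damped oscillators with stiffness `m = 1 + n²`, coupled only through the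
coefficients of `sin (β u)`, which are bounded by `1`. Each real or imaginary part of a mode
therefore solves `u'' + u' + m u = -f + σ ḃ` with `|f| ≤ |γ|`, `σ² ≤ 2` and `b` a scalar Brownian
path. It suffices to control each oscillator with constants independent of `n`: `‖(u, v)‖²` is the
sum of the mode energies `m |u|² + |v|²` with weights `⟨n⟩^(2(α-1))`, summable because `α < 1/2`.
Jensen's inequality (`ofReal_exp_le_tsum`) for the normalized weights then transfers the bound to
the norm without any information on the joint law of the modes, which the sine correlates.

For one oscillator, Duhamel's formula splits the state into free evolution, forced response and
stochastic convolution. The squares of the last two are harmless: the kernels decay like `exp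
(-t/2)`, and a Gaussian of bounded variance has a small exponential square moment. The delicate term
is the cross term of the noise with the free evolution. It is Gaussian with variance quadratic in
the initial data, while the initial energy may enter the exponent only with coefficient `1`.

For `t ≤ 5` the exact energy identity `free_energy` supplies a gain of `2 ∫ z²`, where `z` is the
free velocity. `integral_responseWeight_sq_le` bounds the variance of the cross term by a multiple
of the same `∫ z²`. Since the Gaussian cost is quadratic in `μ` and the gain linear, one copy of `∫
z²` pays for the noise when `μ` is small (`lintegral_exp_energyFluctuation_le`), and the other pays
for the force. For `t > 5` the crude decay `free_energy_le_exp` makes the coefficient of the initial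
energy at most `40 exp (-t) ≤ 1/2`, and `exp_contraction_mul_le` converts this into the factor `exp
(-t)` plus a constant. -/

/-- Riemann sums with tags `τ` at one of the endpoints, for an integrand with a frozen variable. -/
lemma tendsto_sum_integral_tag {F : ℝ → ℝ → ℝ} (hF : Continuous (Function.uncurry F)) {T : ℝ}
    (hT : 0 ≤ T) (e : ℕ) (he : e ≤ 1) :
    Tendsto (fun N : ℕ => ∑ i ∈ range N,
        ∫ s in (T * (i / N))..(T * ((i + 1 : ℕ) / N)), F s (T * ((i + e : ℕ) / N)))
      atTop (𝓝 (∫ s in (0 : ℝ)..T, F s s)) := by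
  have hK : IsCompact (Set.Icc (0 : ℝ) T ×ˢ Set.Icc (0 : ℝ) T) := isCompact_Icc.prod isCompact_Icc
  have hU := hK.uniformContinuousOn_of_continuous hF.continuousOn
  rw [Metric.uniformContinuousOn_iff] at hU
  rw [Metric.tendsto_atTop]
  intro η hη
  -- Dividing by `T + 1` allows `T = 0` and makes the total error `η T / (T + 1)` strictly below
  -- `η`.
  obtain ⟨δ, hδ, hd⟩ := hU (η / (T + 1)) (by positivity)
  obtain ⟨N₀, hN₀⟩ := exists_nat_gt (T / δ)
  refine ⟨N₀ + 1, fun N hN => ?_⟩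
  have hNpos : (0 : ℝ) < N := by exact_mod_cast (by omega : 0 < N)
  have hTN : T / N < δ := by
    rw [div_lt_iff₀ hNpos]
    rw [div_lt_iff₀ hδ] at hN₀
    have : (N₀ : ℝ) ≤ N := by exact_mod_cast (by omega : N₀ ≤ N)
    nlinarith
  have hcd : Continuous fun s => F s s := hF.comp (continuous_id.prodMk continuous_id)
  have hct : ∀ r, Continuous fun s => F s r := fun r =>
    hF.comp (continuous_id.prodMk continuous_const)
  have hsum : ∫ s in (0 : ℝ)..T, F s s = ∑ i ∈ range N,
      ∫ s in (T * (i / N))..(T * ((i + 1 : ℕ) / N)), F s s := by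
    rw [intervalIntegral.sum_integral_adjacent_intervals (a := fun i : ℕ => T * ((i : ℝ) / N))
      (fun i _ => hcd.intervalIntegrable _ _)]
    simp [hNpos.ne']
  rw [hsum, Real.dist_eq, ← Finset.sum_sub_distrib]
  have hterm : ∀ i ∈ range N,
      |(∫ s in (T * (i / N))..(T * ((i + 1 : ℕ) / N)), F s (T * ((i + e : ℕ) / N)))
        - ∫ s in (T * (i / N))..(T * ((i + 1 : ℕ) / N)), F s s| ≤ η / (T + 1) * (T / N) := by
    intro i hi
    have hi' : ((i : ℝ) + 1) ≤ N := by exact_mod_cast Finset.mem_range.1 hi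
    have hi0 : (0 : ℝ) ≤ i := Nat.cast_nonneg i
    have he' : (e : ℝ) ≤ 1 := by exact_mod_cast he
    have he0 : (0 : ℝ) ≤ e := Nat.cast_nonneg e
    have hlen : T * ((i + 1 : ℕ) / N) - T * (i / N) = T / N := by
      push_cast; field_simp; ring
    have hTNn : 0 ≤ T / N := by positivity
    have hle : T * ((i : ℝ) / N) ≤ T * ((i + 1 : ℕ) / N) := by linarith
    have ha : 0 ≤ T * ((i : ℝ) / N) := by positivity
    have hb : T * (((i + 1 : ℕ) : ℝ) / N) ≤ T := by
      have : ((i + 1 : ℕ) : ℝ) / N ≤ 1 := by rw [div_le_one hNpos]; push_cast; exact hi'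
      nlinarith
    have htag : T * (((i + e : ℕ) : ℝ) / N) = T * (i / N) + e * (T / N) := by
      push_cast; field_simp
    rw [← intervalIntegral.integral_sub ((hct _).intervalIntegrable _ _)
      (hcd.intervalIntegrable _ _), ← Real.norm_eq_abs]
    refine (intervalIntegral.norm_integral_le_of_norm_le_const (C := η / (T + 1)) ?_).trans ?_
    · intro s hs
      rw [Set.uIoc_of_le hle] at hs
      have h1 := mul_le_mul_of_nonneg_right he' hTNn
      have h2 := mul_nonneg he0 hTNn
      have := hd (s, T * ((i + e : ℕ) / N)) ⟨⟨by linarith [hs.1], by linarith [hs.2]⟩,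
        ⟨by dsimp only; rw [htag]; linarith, by dsimp only; rw [htag]; linarith⟩⟩ (s, s)
        ⟨⟨by linarith [hs.1], by linarith [hs.2]⟩, ⟨by linarith [hs.1], by linarith [hs.2]⟩⟩ ?_
      · exact this.le
      · rw [Prod.dist_eq]
        simp only [dist_self]
        rw [max_eq_right dist_nonneg, Real.dist_eq, abs_lt, htag]
        constructor <;> linarith [hs.1, hs.2]
    · rw [hlen, abs_of_nonneg hTNn]
  calc |∑ i ∈ range N, _| ≤ ∑ i ∈ range N, η / (T + 1) * (T / N) :=
        (Finset.abs_sum_le_sum_abs _ _).trans (Finset.sum_le_sum hterm)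
    _ = η * (T / (T + 1)) := by
        rw [Finset.sum_const, card_range, nsmul_eq_mul]; field_simp
    _ < η := by
        have : T / (T + 1) < 1 := by rw [div_lt_one (by linarith)]; linarith
        nlinarith

noncomputable section

/-- The Wiener integral `∫₀ᵗ φ db` of a `C¹` function `φ` with derivative `φ'` against a continuous
path `b` with `b 0 = 0`, defined by integration by parts. -/
def wienerIntegral (φ φ' b : ℝ → ℝ) (t : ℝ) : ℝ := φ t * b t - ∫ s in (0 : ℝ)..t, φ' s * b s

end

/-- Summation by parts: with `φ` taken at right endpoints, `b` is left at left endpoints against `∫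
φ'` over each cell, hence the tag `e = 0`. -/
lemma tendsto_wienerIntegral {φ φ' b : ℝ → ℝ} (hφ : ∀ s, HasDerivAt φ (φ' s) s)
    (hφ' : Continuous φ') (hb : Continuous b) (hb0 : b 0 = 0) {T : ℝ} (hT : 0 ≤ T) :
    Tendsto (fun N : ℕ => ∑ i ∈ range N, φ (T * ((i + 1 : ℕ) / N)) *
        (b (T * ((i + 1 : ℕ) / N)) - b (T * (i / N))))
      atTop (𝓝 (wienerIntegral φ φ' b T)) := by
  have h := tendsto_sum_integral_tag (F := fun s r => φ' s * b r)
    ((hφ'.comp continuous_fst).mul (hb.comp continuous_snd)) hT 0 (by norm_num)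
  refine (h.const_sub (φ T * b T)).congr' ?_
  filter_upwards [eventually_gt_atTop 0] with N hN
  have hNpos : (N : ℝ) ≠ 0 := by positivity
  have htel := Finset.sum_range_sub (fun i : ℕ => φ (T * (i / N)) * b (T * (i / N))) N
  simp only [Nat.cast_zero, zero_div, mul_zero, hb0, sub_zero, div_self hNpos, mul_one] at htel
  rw [← htel, ← Finset.sum_sub_distrib]
  refine Finset.sum_congr rfl fun i _ => ?_
  rw [intervalIntegral.integral_mul_const,
    intervalIntegral.integral_eq_sub_of_hasDerivAt (fun s _ => hφ s) (hφ'.intervalIntegrable _ _)]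
  simp only [add_zero]
  ring

section Brownian

variable {Ω : Type*} [MeasurableSpace Ω] {P : Measure Ω} {B : ℝ≥0 → Ω → ℝ}

lemma hasSubgaussianMGF_increment (hB : IsBrownianReal B P) (s t : ℝ≥0) :
    HasSubgaussianMGF (fun ω => B s ω - B t ω) (nndist s t) P := by
  have hmap := (hB.hasLaw_sub s t).map_eq
  have hm : AEMeasurable (B s - B t) P := (hB.hasLaw_sub s t).aemeasurable
  constructor
  · intro c
    have := integrable_exp_mul_gaussianReal (μ := 0) (v := nndist s.1 t.1) c
    rw [← hmap] at this
    exact (integrable_map_measure (by fun_prop) hm).1 this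
  · intro c
    refine (mgf_gaussianReal hmap c).le.trans (le_of_eq ?_)
    congr 1
    rw [zero_mul, zero_add]
    rfl

lemma aemeasurable_wienerIntegral (hB : IsBrownianReal B P) {φ φ' : ℝ → ℝ}
    (hφ : ∀ s, HasDerivAt φ (φ' s) s) (hφ' : Continuous φ') {T : ℝ} (hT : 0 ≤ T) :
    AEMeasurable (fun ω => wienerIntegral φ φ' (fun s => B s.toNNReal ω) T) P := by
  have hmeas := fun t => hB.aemeasurable t
  refine aemeasurable_of_tendsto_metrizable_ae atTop
    (f := fun (N : ℕ) ω => ∑ i ∈ range N, φ (T * ((i + 1 : ℕ) / N)) *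
        (B (T * ((i + 1 : ℕ) / N)).toNNReal ω - B (T * (i / N)).toNNReal ω)) (fun N => ?_) ?_
  · exact Finset.aemeasurable_fun_sum _ fun i _ => ((hmeas _).sub (hmeas _)).const_mul _
  · filter_upwards [hB.cont, hB.eval_zero_ae_eq_zero] with ω h1 h2
    exact tendsto_wienerIntegral hφ hφ' (b := fun s => B s.toNNReal ω)
      (h1.comp continuous_real_toNNReal) (by simpa using h2) hT

/-- The Wiener integral of `φ` is sub-Gaussian with variance `∫ φ²`. -/
lemma lintegral_exp_wienerIntegral_le (hB : IsBrownianReal B P) {φ φ' : ℝ → ℝ}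
    (hφ : ∀ s, HasDerivAt φ (φ' s) s) (hφ' : Continuous φ') {T : ℝ} (hT : 0 ≤ T) (c : ℝ) :
    ∫⁻ ω, ENNReal.ofReal (Real.exp (c * wienerIntegral φ φ' (fun s => B s.toNNReal ω) T)) ∂P
      ≤ ENNReal.ofReal (Real.exp (c ^ 2 / 2 * ∫ s in (0 : ℝ)..T, φ s ^ 2)) := by
  have hmeas := fun t => hB.aemeasurable t
  have hcφ : Continuous φ := continuous_iff_continuousAt.2 fun s => (hφ s).continuousAt
  let X : ℕ → Ω → ℝ := fun N ω => ∑ i ∈ range N, φ (T * ((i + 1 : ℕ) / N)) *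
        (B (T * ((i + 1 : ℕ) / N)).toNNReal ω - B (T * (i / N)).toNNReal ω)
  let Q : ℕ → ℝ := fun N => ∑ i ∈ range N, ∫ s in (T * (i / N))..(T * ((i + 1 : ℕ) / N)),
        φ (T * ((i + 1 : ℕ) / N)) ^ 2
  have hX : ∀ N, AEMeasurable (X N) P := fun N =>
    Finset.aemeasurable_fun_sum _ fun i _ => ((hmeas _).sub (hmeas _)).const_mul _
  -- The tag is `e = 1` here, because the sums `X N` weight each increment by `φ` at the right
  -- endpoint.
  have hQ : Tendsto Q atTop (𝓝 (∫ s in (0 : ℝ)..T, φ s ^ 2)) :=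
    tendsto_sum_integral_tag (F := fun _ r => φ r ^ 2) ((hcφ.comp continuous_snd).pow 2) hT 1 le_rfl
  have hbound : ∀ N, ∫⁻ ω, ENNReal.ofReal (Real.exp (c * X N ω)) ∂P
      ≤ ENNReal.ofReal (Real.exp (c ^ 2 / 2 * Q N)) := by
    intro N
    have hmono : Monotone fun i : ℕ => (T * ((i : ℝ) / N)).toNNReal := by
      intro i j hij
      apply Real.toNNReal_mono
      gcongr
    have hind := hB.hasIndepIncrements.nat hmono
    have hind' := hind.comp (fun i : ℕ => fun x : ℝ => φ (T * ((i + 1 : ℕ) / N)) * x)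
      (fun i => measurable_const_mul _)
    have hsub := HasSubgaussianMGF.sum_of_iIndepFun hind' (s := range N)
      (fun i _ => (hasSubgaussianMGF_increment hB _ _).const_mul (φ (T * ((i + 1 : ℕ) / N))))
    have h1 : ∫⁻ ω, ENNReal.ofReal (Real.exp (c * X N ω)) ∂P = ENNReal.ofReal (mgf (X N) P c) :=
      (ofReal_integral_eq_lintegral_ofReal (hsub.integrable_exp_mul c)
        (ae_of_all _ fun _ => (Real.exp_pos _).le)).symm
    rw [h1]
    refine ENNReal.ofReal_le_ofReal ((hsub.mgf_le c).trans (le_of_eq ?_))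
    congr 1
    have : ((∑ i ∈ range N, (⟨φ (T * ((i + 1 : ℕ) / N)) ^ 2, sq_nonneg _⟩ *
        nndist (T * ((i + 1 : ℕ) / N)).toNNReal (T * ((i : ℝ) / N)).toNNReal : ℝ≥0) : ℝ≥0) : ℝ)
        = Q N := by
      rw [NNReal.coe_sum]
      refine Finset.sum_congr rfl fun i _ => ?_
      refine (NNReal.coe_mul _ _).trans ?_
      rw [intervalIntegral.integral_const, coe_nndist, NNReal.dist_eq,
        Real.coe_toNNReal _ (by positivity), Real.coe_toNNReal _ (by positivity), smul_eq_mul,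
        mul_comm, abs_of_nonneg]
      · rfl
      · rw [sub_nonneg]; gcongr; simp
    rw [← this]
    ring
  have hlim : ∀ᵐ ω ∂P, Tendsto (fun N => ENNReal.ofReal (Real.exp (c * X N ω))) atTop
      (𝓝 (ENNReal.ofReal
        (Real.exp (c * wienerIntegral φ φ' (fun s => B s.toNNReal ω) T)))) := by
    filter_upwards [hB.cont, hB.eval_zero_ae_eq_zero] with ω h1 h2
    have h3 := tendsto_wienerIntegral hφ hφ' (b := fun s => B s.toNNReal ω)
      (h1.comp continuous_real_toNNReal) (by simpa using h2) hT
    exact ENNReal.tendsto_ofReal ((Real.continuous_exp.tendsto _).comp (h3.const_mul c))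
  -- Fatou's lemma: only an upper bound is needed, so almost sure convergence of the Riemann sums
  -- suffices.
  calc ∫⁻ ω, ENNReal.ofReal (Real.exp (c * wienerIntegral φ φ' (fun s => B s.toNNReal ω) T)) ∂P
      = ∫⁻ ω, liminf (fun N => ENNReal.ofReal (Real.exp (c * X N ω))) atTop ∂P :=
        lintegral_congr_ae (hlim.mono fun ω h => h.liminf_eq.symm)
    _ ≤ liminf (fun N => ∫⁻ ω, ENNReal.ofReal (Real.exp (c * X N ω)) ∂P) atTop :=
        lintegral_liminf_le' fun N => ((hX N).const_mul c).exp.ennreal_ofReal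
    _ ≤ liminf (fun N => ENNReal.ofReal (Real.exp (c ^ 2 / 2 * Q N))) atTop :=
        liminf_le_liminf (Eventually.of_forall hbound)
    _ = _ := (ENNReal.tendsto_ofReal
        ((Real.continuous_exp.tendsto _).comp (hQ.const_mul _))).liminf_eq

end Brownian

lemma lintegral_exp_sq_gaussianReal_le :
    ∫⁻ g, ENNReal.ofReal (Real.exp (g ^ 2 / 4)) ∂(gaussianReal 0 1) ≤ 2 := by
  rw [gaussianReal_of_var_ne_zero _ one_ne_zero,
    lintegral_withDensity_eq_lintegral_mul _ (measurable_gaussianPDF 0 1) (by fun_prop)]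
  have h : ∀ g : ℝ, (gaussianPDF 0 1 * fun g : ℝ => ENNReal.ofReal (Real.exp (g ^ 2 / 4))) g
      = ENNReal.ofReal ((√(2 * Real.pi))⁻¹ * Real.exp (-(1 / 4) * g ^ 2)) := by
    intro g
    rw [Pi.mul_apply, gaussianPDF, ← ENNReal.ofReal_mul (gaussianPDFReal_nonneg _ _ _),
      gaussianPDFReal, mul_assoc, ← Real.exp_add]
    simp only [NNReal.coe_one, mul_one, sub_zero]
    congr 3
    ring
  simp_rw [h]
  rw [← ofReal_integral_eq_lintegral_ofReal
    ((integrable_exp_neg_mul_sq (by norm_num)).const_mul _) (ae_of_all _ fun _ => by positivity),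
    integral_const_mul, integral_gaussian]
  rw [← ENNReal.ofReal_ofNat]
  refine ENNReal.ofReal_le_ofReal ?_
  have : √(Real.pi / (1 / 4)) = √2 * √(2 * Real.pi) := by
    rw [← Real.sqrt_mul (by norm_num)]; congr 1; ring
  rw [this, mul_comm, mul_assoc, mul_inv_cancel₀ (by positivity), mul_one]
  rw [Real.sqrt_le_left (by norm_num)]
  norm_num

/-- Exponential square moments of a sub-Gaussian variable. -/
lemma lintegral_exp_sq_le {Ω : Type*} [MeasurableSpace Ω] {P : Measure Ω} [IsProbabilityMeasure P]
    {X : Ω → ℝ} (hX : AEMeasurable X P) {σ : ℝ}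
    (h : ∀ c : ℝ, ∫⁻ ω, ENNReal.ofReal (Real.exp (c * X ω)) ∂P
      ≤ ENNReal.ofReal (Real.exp (c ^ 2 / 2 * σ))) {μ : ℝ} (hμ : 0 ≤ μ) (hμσ : μ * σ ≤ 1 / 4) :
    ∫⁻ ω, ENNReal.ofReal (Real.exp (μ * X ω ^ 2)) ∂P ≤ 2 := by
  -- Linearization of the square by an auxiliary standard Gaussian `g`. After Fubini the hypothesis
  -- is applied with `c = √(2μ) g`, which leaves `exp (μ σ g²) ≤ exp (g² / 4)`.
  have key : ∀ x : ℝ, ENNReal.ofReal (Real.exp (μ * x ^ 2)) =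
      ∫⁻ g, ENNReal.ofReal (Real.exp (√(2 * μ) * g * x)) ∂(gaussianReal 0 1) := by
    intro x
    have h1 := mgf_gaussianReal (p := gaussianReal 0 1) (X := id) (μ := 0) (v := 1)
      Measure.map_id (√(2 * μ) * x)
    have h2 := integrable_exp_mul_gaussianReal (μ := 0) (v := 1) (√(2 * μ) * x)
    have h3 : ∀ g : ℝ, √(2 * μ) * g * x = √(2 * μ) * x * g := fun g => by ring
    simp_rw [h3]
    rw [← ofReal_integral_eq_lintegral_ofReal h2 (ae_of_all _ fun _ => (Real.exp_pos _).le)]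
    congr 1
    refine Eq.trans ?_ h1.symm
    congr 1
    rw [mul_pow, Real.sq_sqrt (by positivity)]
    push_cast
    ring
  simp_rw [key]
  rw [lintegral_lintegral_swap]
  · calc _ ≤ ∫⁻ g, ENNReal.ofReal (Real.exp (g ^ 2 / 4)) ∂(gaussianReal 0 1) := by
          refine lintegral_mono fun g => (h _).trans (ENNReal.ofReal_le_ofReal ?_)
          rw [Real.exp_le_exp, mul_pow, Real.sq_sqrt (by positivity)]
          nlinarith [sq_nonneg g]
      _ ≤ 2 := lintegral_exp_sq_gaussianReal_le
  · have h1 : AEMeasurable (fun p : Ω × ℝ => X p.1) (P.prod (gaussianReal 0 1)) :=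
      hX.comp_quasiMeasurePreserving Measure.quasiMeasurePreserving_fst
    exact (((measurable_snd.aemeasurable).const_mul _).mul h1).exp.ennreal_ofReal

end SineGordon

/-! ### The free damped oscillator: kernels, energy and dissipation. -/

namespace SineGordon

noncomputable section

/-- The solution `k` of `k'' + k' + m k = 0`, `k 0 = 0`, `k' 0 = 1`. -/
def kernel (m t : ℝ) : ℝ := Real.exp (-t / 2) * (Real.sin (√(m - 1 / 4) * t) / √(m - 1 / 4))

/-- The derivative of `kernel m`. -/
def kernelDeriv (m t : ℝ) : ℝ :=
  Real.exp (-t / 2) * (Real.cos (√(m - 1 / 4) * t)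
    - Real.sin (√(m - 1 / 4) * t) / (2 * √(m - 1 / 4)))

/-- The position at time `t` of the free damped oscillator `y'' + y' + m y = 0`
started from `(a, b)`. -/
def freePos (m a b t : ℝ) : ℝ := (kernel m t + kernelDeriv m t) * a + kernel m t * b

/-- The velocity at time `t` of the free damped oscillator started from `(a, b)`. -/
def freeVel (m a b t : ℝ) : ℝ := -(m * kernel m t) * a + kernelDeriv m t * b

end

variable {m : ℝ}

lemma kernel_zero (m : ℝ) : kernel m 0 = 0 := by simp [kernel]

lemma kernelDeriv_zero (m : ℝ) : kernelDeriv m 0 = 1 := by simp [kernelDeriv]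

lemma hasDerivAt_kernel (hm : 1 ≤ m) (t : ℝ) : HasDerivAt (kernel m) (kernelDeriv m t) t := by
  have hρ : 0 < √(m - 1 / 4) := Real.sqrt_pos.2 (by linarith)
  have h1 : HasDerivAt (fun t : ℝ => Real.exp (-t / 2)) (Real.exp (-t / 2) * (-1 / 2)) t :=
    (((hasDerivAt_id t).neg).div_const 2).exp
  have h2 : HasDerivAt (fun t : ℝ => Real.sin (√(m - 1 / 4) * t))
      (Real.cos (√(m - 1 / 4) * t) * (√(m - 1 / 4) * 1)) t :=
    ((hasDerivAt_id t).const_mul _).sin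
  refine (h1.mul (h2.div_const √(m - 1 / 4))).congr_deriv ?_
  rw [kernelDeriv]
  generalize √(m - 1 / 4) = ρ at *
  field_simp
  ring

lemma hasDerivAt_kernelDeriv (hm : 1 ≤ m) (t : ℝ) :
    HasDerivAt (kernelDeriv m) (-kernelDeriv m t - m * kernel m t) t := by
  have hρ : 0 < √(m - 1 / 4) := Real.sqrt_pos.2 (by linarith)
  have hsq : √(m - 1 / 4) ^ 2 = m - 1 / 4 := Real.sq_sqrt (by linarith)
  have h1 : HasDerivAt (fun t : ℝ => Real.exp (-t / 2)) (Real.exp (-t / 2) * (-1 / 2)) t :=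
    (((hasDerivAt_id t).neg).div_const 2).exp
  have h2 : HasDerivAt (fun t : ℝ => Real.sin (√(m - 1 / 4) * t))
      (Real.cos (√(m - 1 / 4) * t) * (√(m - 1 / 4) * 1)) t :=
    ((hasDerivAt_id t).const_mul _).sin
  have h3 : HasDerivAt (fun t : ℝ => Real.cos (√(m - 1 / 4) * t))
      (-Real.sin (√(m - 1 / 4) * t) * (√(m - 1 / 4) * 1)) t :=
    ((hasDerivAt_id t).const_mul _).cos
  refine (h1.mul (h3.sub (h2.div_const (2 * √(m - 1 / 4))))).congr_deriv ?_
  -- Eliminating `m` in favour of the frequency turns the goal into a rational identity in `ρ`.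
  have hm' : m = √(m - 1 / 4) ^ 2 + 1 / 4 := by rw [hsq]; ring
  rw [kernelDeriv, kernel, Pi.sub_apply]
  generalize √(m - 1 / 4) = ρ at *
  subst hm'
  field_simp
  ring

lemma continuous_kernel (hm : 1 ≤ m) : Continuous (kernel m) :=
  continuous_iff_continuousAt.2 fun t => (hasDerivAt_kernel hm t).continuousAt

lemma continuous_kernelDeriv (hm : 1 ≤ m) : Continuous (kernelDeriv m) :=
  continuous_iff_continuousAt.2 fun t => (hasDerivAt_kernelDeriv hm t).continuousAt

lemma mul_kernel_sq_le (hm : 1 ≤ m) (t : ℝ) : m * kernel m t ^ 2 ≤ 2 * Real.exp (-t) := by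
  have hρ : 0 < √(m - 1 / 4) := Real.sqrt_pos.2 (by linarith)
  have hsq : √(m - 1 / 4) ^ 2 = m - 1 / 4 := Real.sq_sqrt (by linarith)
  have he : Real.exp (-t / 2) ^ 2 = Real.exp (-t) := by
    rw [← Real.exp_nat_mul]; congr 1; push_cast; ring
  rw [kernel, mul_pow, he, div_pow, hsq]
  have h1 := Real.sin_sq_le_one (√(m - 1 / 4) * t)
  have h2 : m * (Real.sin (√(m - 1 / 4) * t) ^ 2 / (m - 1 / 4)) ≤ 2 := by
    rw [mul_div_assoc', div_le_iff₀ (by linarith)]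
    nlinarith
  nlinarith [Real.exp_pos (-t)]

lemma kernelDeriv_sq_le (hm : 1 ≤ m) (t : ℝ) : kernelDeriv m t ^ 2 ≤ 2 * Real.exp (-t) := by
  have hρ : 0 < √(m - 1 / 4) := Real.sqrt_pos.2 (by linarith)
  have hsq : √(m - 1 / 4) ^ 2 = m - 1 / 4 := Real.sq_sqrt (by linarith)
  have he : Real.exp (-t / 2) ^ 2 = Real.exp (-t) := by
    rw [← Real.exp_nat_mul]; congr 1; push_cast; ring
  rw [kernelDeriv, mul_pow, he, mul_comm]
  refine mul_le_mul_of_nonneg_right ?_ (Real.exp_pos _).le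
  have h1 := Real.sin_sq_add_cos_sq (√(m - 1 / 4) * t)
  set S := Real.sin (√(m - 1 / 4) * t)
  set C := Real.cos (√(m - 1 / 4) * t)
  have h2 : (S / (2 * √(m - 1 / 4))) ^ 2 ≤ S ^ 2 := by
    rw [div_pow, mul_pow, hsq]
    exact div_le_self (sq_nonneg _) (by linarith)
  nlinarith [sq_nonneg (C + S / (2 * √(m - 1 / 4)))]

lemma freePos_zero (m a b : ℝ) : freePos m a b 0 = a := by
  simp [freePos, kernel_zero, kernelDeriv_zero]

lemma freeVel_zero (m a b : ℝ) : freeVel m a b 0 = b := by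
  simp [freeVel, kernel_zero, kernelDeriv_zero]

lemma hasDerivAt_freePos (hm : 1 ≤ m) (a b t : ℝ) :
    HasDerivAt (freePos m a b) (freeVel m a b t) t := by
  refine ((((hasDerivAt_kernel hm t).add (hasDerivAt_kernelDeriv hm t)).mul_const a).add
    ((hasDerivAt_kernel hm t).mul_const b)).congr_deriv ?_
  rw [freeVel]; ring

lemma hasDerivAt_freeVel (hm : 1 ≤ m) (a b t : ℝ) :
    HasDerivAt (freeVel m a b) (-freeVel m a b t - m * freePos m a b t) t := by
  refine ((((hasDerivAt_kernel hm t).const_mul m).neg.mul_const a).add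
    ((hasDerivAt_kernelDeriv hm t).mul_const b)).congr_deriv ?_
  rw [freeVel, freePos]; ring

lemma continuous_freeVel (hm : 1 ≤ m) (a b : ℝ) : Continuous (freeVel m a b) :=
  continuous_iff_continuousAt.2 fun t => (hasDerivAt_freeVel hm a b t).continuousAt

/-- The energy identity of the free damped oscillator. -/
lemma free_energy (hm : 1 ≤ m) (a b t : ℝ) :
    m * freePos m a b t ^ 2 + freeVel m a b t ^ 2
      = m * a ^ 2 + b ^ 2 - 2 * ∫ s in (0 : ℝ)..t, freeVel m a b s ^ 2 := by
  have h : ∀ s, HasDerivAt (fun s => m * freePos m a b s ^ 2 + freeVel m a b s ^ 2)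
      (-2 * freeVel m a b s ^ 2) s := by
    intro s
    refine ((((hasDerivAt_freePos hm a b s).pow 2).const_mul m).add
      ((hasDerivAt_freeVel hm a b s).pow 2)).congr_deriv ?_
    push_cast; ring
  have h1 := intervalIntegral.integral_eq_sub_of_hasDerivAt (a := 0) (b := t) (fun s _ => h s)
    ((((continuous_freeVel hm a b).pow 2).const_mul (-2)).intervalIntegrable _ _)
  rw [intervalIntegral.integral_const_mul, freePos_zero, freeVel_zero] at h1
  linarith

/-- Inserting the kernel bounds into the explicit solution gives true exponential decay, which the
energy identity alone does not. The constant `20` exceeds `1`, so this is useful only for large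
times. -/
lemma free_energy_le_exp (hm : 1 ≤ m) (a b t : ℝ) :
    m * freePos m a b t ^ 2 + freeVel m a b t ^ 2
      ≤ 20 * Real.exp (-t) * (m * a ^ 2 + b ^ 2) := by
  have hk := mul_kernel_sq_le hm t
  have hh := kernelDeriv_sq_le hm t
  have hk' : kernel m t ^ 2 ≤ 2 * Real.exp (-t) := by nlinarith [sq_nonneg (kernel m t)]
  have he := Real.exp_pos (-t)
  rw [freePos, freeVel]
  set k := kernel m t
  set h := kernelDeriv m t
  set e := Real.exp (-t)
  have hma : 0 ≤ m * a ^ 2 := by positivity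
  have h1 : ((k + h) * a + k * b) ^ 2 ≤ 4 * (k ^ 2 + h ^ 2) * a ^ 2 + 2 * k ^ 2 * b ^ 2 := by
    nlinarith [sq_nonneg ((k + h) * a - k * b), mul_nonneg (sq_nonneg (k - h)) (sq_nonneg a)]
  have h2 : (-(m * k) * a + h * b) ^ 2 ≤ 2 * (m * k ^ 2) * (m * a ^ 2) + 2 * h ^ 2 * b ^ 2 := by
    nlinarith [sq_nonneg (-(m * k) * a - h * b)]
  have h3 : m * ((k + h) * a + k * b) ^ 2
      ≤ 4 * (k ^ 2 + h ^ 2) * (m * a ^ 2) + 2 * (m * k ^ 2) * b ^ 2 := by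
    nlinarith [mul_le_mul_of_nonneg_left h1 (by linarith : (0 : ℝ) ≤ m)]
  have h4 := mul_le_mul_of_nonneg_right hk' hma
  have h5 := mul_le_mul_of_nonneg_right hh hma
  have h6 := mul_le_mul_of_nonneg_right hk (sq_nonneg b)
  have h7 := mul_le_mul_of_nonneg_right hh (sq_nonneg b)
  have h8 := mul_le_mul_of_nonneg_right hk hma
  have h9 : 0 ≤ e * b ^ 2 := by positivity
  linarith

noncomputable section

/-- The energy pairing of the free evolution of `(a, b)` at time `t` with the response at time `t`
to a unit impulse at time `s`. -/
def responseWeight (m a b t s : ℝ) : ℝ :=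
  m * freePos m a b t * kernel m (t - s) + freeVel m a b t * kernelDeriv m (t - s)

/-- The derivative of `responseWeight` in the last variable. -/
def responseWeightDeriv (m a b t s : ℝ) : ℝ :=
  -(m * freePos m a b t * kernelDeriv m (t - s))
    + freeVel m a b t * (kernelDeriv m (t - s) + m * kernel m (t - s))

end

lemma hasDerivAt_kernel_sub (hm : 1 ≤ m) (t s : ℝ) :
    HasDerivAt (fun s => kernel m (t - s)) (-kernelDeriv m (t - s)) s := by
  refine ((hasDerivAt_kernel hm (t - s)).comp s ((hasDerivAt_id s).const_sub t)).congr_deriv ?_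
  ring

lemma hasDerivAt_kernelDeriv_sub (hm : 1 ≤ m) (t s : ℝ) :
    HasDerivAt (fun s => kernelDeriv m (t - s))
      (kernelDeriv m (t - s) + m * kernel m (t - s)) s := by
  refine ((hasDerivAt_kernelDeriv hm (t - s)).comp s
    ((hasDerivAt_id s).const_sub t)).congr_deriv ?_
  ring

lemma continuous_kernel_sub (hm : 1 ≤ m) (t : ℝ) : Continuous fun s => kernel m (t - s) :=
  (continuous_kernel hm).comp (continuous_const.sub continuous_id)

lemma continuous_kernelDeriv_sub (hm : 1 ≤ m) (t : ℝ) :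
    Continuous fun s => kernelDeriv m (t - s) :=
  (continuous_kernelDeriv hm).comp (continuous_const.sub continuous_id)

lemma hasDerivAt_responseWeight (hm : 1 ≤ m) (a b t s : ℝ) :
    HasDerivAt (responseWeight m a b t) (responseWeightDeriv m a b t s) s := by
  refine (((hasDerivAt_kernel_sub hm t s).const_mul (m * freePos m a b t)).add
    ((hasDerivAt_kernelDeriv_sub hm t s).const_mul (freeVel m a b t))).congr_deriv ?_
  rw [responseWeightDeriv]; ring

lemma continuous_responseWeight (hm : 1 ≤ m) (a b t : ℝ) :
    Continuous (responseWeight m a b t) :=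
  continuous_iff_continuousAt.2 fun s => (hasDerivAt_responseWeight hm a b t s).continuousAt

lemma continuous_responseWeightDeriv (hm : 1 ≤ m) (a b t : ℝ) :
    Continuous (responseWeightDeriv m a b t) :=
  ((continuous_kernelDeriv_sub hm t).const_mul _).neg.add
    (((continuous_kernelDeriv_sub hm t).add ((continuous_kernel_sub hm t).const_mul _)).const_mul _)

/-- Polarized energy identity for two free solutions: the one from `(a, b)`, and the impulse
response started at time `s` from `(0, 1)`. Their pairing at time `s` is the free velocity, and it
dissipates at rate twice the product of velocities. -/
lemma responseWeight_eq (hm : 1 ≤ m) (a b t s : ℝ) :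
    responseWeight m a b t s
      = freeVel m a b s - 2 * ∫ τ in s..t, freeVel m a b τ * kernelDeriv m (τ - s) := by
  have hk : ∀ τ, HasDerivAt (fun τ => kernel m (τ - s)) (kernelDeriv m (τ - s)) τ := fun τ =>
    (hasDerivAt_kernel hm (τ - s)).comp_sub_const τ s
  have hh : ∀ τ, HasDerivAt (fun τ => kernelDeriv m (τ - s))
      (-kernelDeriv m (τ - s) - m * kernel m (τ - s)) τ := fun τ =>
    (hasDerivAt_kernelDeriv hm (τ - s)).comp_sub_const τ s
  have h : ∀ τ, HasDerivAt (fun τ => m * freePos m a b τ * kernel m (τ - s)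
      + freeVel m a b τ * kernelDeriv m (τ - s))
      (-2 * (freeVel m a b τ * kernelDeriv m (τ - s))) τ := by
    intro τ
    refine ((((hasDerivAt_freePos hm a b τ).const_mul m).mul (hk τ)).add
      ((hasDerivAt_freeVel hm a b τ).mul (hh τ))).congr_deriv ?_
    ring
  have hc : Continuous fun τ => freeVel m a b τ * kernelDeriv m (τ - s) :=
    (continuous_freeVel hm a b).mul
      ((continuous_kernelDeriv hm).comp (continuous_id.sub continuous_const))
  have h1 := intervalIntegral.integral_eq_sub_of_hasDerivAt (a := s) (b := t) (fun τ _ => h τ)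
    ((hc.const_mul (-2)).intervalIntegrable _ _)
  rw [intervalIntegral.integral_const_mul, sub_self, kernel_zero, kernelDeriv_zero] at h1
  rw [responseWeight]
  linarith

/-- The Cauchy–Schwarz inequality against the constant function `1`. -/
lemma sq_intervalIntegral_le {f : ℝ → ℝ} (hf : Continuous f) {s t : ℝ} (hst : s ≤ t) :
    (∫ τ in s..t, f τ) ^ 2 ≤ (t - s) * ∫ τ in s..t, f τ ^ 2 := by
  rcases hst.eq_or_lt with rfl | hlt
  · simp
  have hpos : 0 < t - s := sub_pos.2 hlt
  set I := ∫ τ in s..t, f τ with hI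
  set c := I / (t - s) with hc
  have h0 : 0 ≤ ∫ τ in s..t, (f τ - c) ^ 2 :=
    intervalIntegral.integral_nonneg hst fun _ _ => sq_nonneg _
  have h1 : ∫ τ in s..t, (f τ - c) ^ 2
      = (∫ τ in s..t, f τ ^ 2) - 2 * c * I + c ^ 2 * (t - s) := by
    have : ∀ τ, (f τ - c) ^ 2 = f τ ^ 2 - 2 * c * f τ + c ^ 2 := fun τ => by ring
    simp_rw [this]
    rw [intervalIntegral.integral_add (Continuous.intervalIntegrable (by fun_prop) _ _)
      (Continuous.intervalIntegrable (by fun_prop) _ _),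
      intervalIntegral.integral_sub (Continuous.intervalIntegrable (by fun_prop) _ _)
      (Continuous.intervalIntegrable (by fun_prop) _ _), intervalIntegral.integral_const_mul,
      intervalIntegral.integral_const, smul_eq_mul, mul_comm (c ^ 2)]
  have hcI : I = c * (t - s) := by rw [hc]; field_simp
  rw [h1, hcI] at h0
  rw [hcI]
  nlinarith

/-- The central estimate. The weight is expressed through the free velocity alone, so its square
integral is controlled by the dissipated energy rather than by the initial energy. -/
lemma integral_responseWeight_sq_le (hm : 1 ≤ m) (a b : ℝ) {t : ℝ} (ht : 0 ≤ t) (ht5 : t ≤ 5) :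
    ∫ s in (0 : ℝ)..t, responseWeight m a b t s ^ 2
      ≤ 402 * ∫ s in (0 : ℝ)..t, freeVel m a b s ^ 2 := by
  set Z := ∫ s in (0 : ℝ)..t, freeVel m a b s ^ 2 with hZ
  have hz := continuous_freeVel hm a b
  have hZ0 : 0 ≤ Z := intervalIntegral.integral_nonneg ht fun _ _ => sq_nonneg _
  have hpt : ∀ s ∈ Set.Icc 0 t,
      responseWeight m a b t s ^ 2 ≤ 2 * freeVel m a b s ^ 2 + 80 * Z := by
    intro s hs
    have hc : Continuous fun τ => freeVel m a b τ * kernelDeriv m (τ - s) :=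
      hz.mul ((continuous_kernelDeriv hm).comp (continuous_id.sub continuous_const))
    set J := ∫ τ in s..t, freeVel m a b τ * kernelDeriv m (τ - s) with hJ
    have h1 : J ^ 2 ≤ (t - s) * ∫ τ in s..t, (freeVel m a b τ * kernelDeriv m (τ - s)) ^ 2 :=
      sq_intervalIntegral_le hc hs.2
    have h2 : ∫ τ in s..t, (freeVel m a b τ * kernelDeriv m (τ - s)) ^ 2 ≤ 2 * Z := by
      calc _ ≤ ∫ τ in s..t, 2 * freeVel m a b τ ^ 2 := by
            refine intervalIntegral.integral_mono_on hs.2 ((hc.pow 2).intervalIntegrable _ _)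
              (((hz.pow 2).const_mul 2).intervalIntegrable _ _) fun τ hτ => ?_
            rw [mul_pow, mul_comm]
            refine mul_le_mul_of_nonneg_right ((kernelDeriv_sq_le hm _).trans ?_) (sq_nonneg _)
            have : Real.exp (-(τ - s)) ≤ 1 := Real.exp_le_one_iff.2 (by linarith [hτ.1])
            linarith
        _ = 2 * ∫ τ in s..t, freeVel m a b τ ^ 2 := intervalIntegral.integral_const_mul _ _
        _ ≤ 2 * Z := by
            refine mul_le_mul_of_nonneg_left ?_ (by norm_num)
            exact intervalIntegral.integral_mono_interval hs.1 hs.2 le_rfl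
              (Filter.Eventually.of_forall fun _ => sq_nonneg _)
              ((hz.pow 2).intervalIntegrable _ _)
    have h3 : J ^ 2 ≤ 10 * Z := by
      have h4 : (t - s) * ∫ τ in s..t, (freeVel m a b τ * kernelDeriv m (τ - s)) ^ 2
          ≤ 5 * (2 * Z) :=
        mul_le_mul (by linarith [hs.1]) h2
          (intervalIntegral.integral_nonneg hs.2 fun _ _ => sq_nonneg _) (by norm_num)
      linarith
    -- `(z - 2J)² ≤ 2z² + 8J²` with `J² ≤ 10 Z`; integrating over a length at most `5` gives `2 + 5
    -- * 80 = 402`.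
    rw [responseWeight_eq hm]
    nlinarith [sq_nonneg (freeVel m a b s + 2 * J)]
  calc _ ≤ ∫ s in (0 : ℝ)..t, (2 * freeVel m a b s ^ 2 + 80 * Z) :=
        intervalIntegral.integral_mono_on ht
          (((continuous_responseWeight hm a b t).pow 2).intervalIntegrable _ _)
          ((((hz.pow 2).const_mul 2).add continuous_const).intervalIntegrable _ _) hpt
    _ = 2 * Z + t * (80 * Z) := by
        rw [intervalIntegral.integral_add (Continuous.intervalIntegrable (by fun_prop) _ _)
          (Continuous.intervalIntegrable (by fun_prop) _ _), intervalIntegral.integral_const_mul,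
          intervalIntegral.integral_const, smul_eq_mul, sub_zero]
    _ ≤ 402 * Z := by nlinarith

/-! ### Duhamel's formula and bounds on the forced response. -/

section Duhamel

variable {u v f b : ℝ → ℝ} {t : ℝ}

lemma integral_exp_sub (t c : ℝ) (hc : c ≠ 0) :
    ∫ s in (0 : ℝ)..t, Real.exp (-(c * (t - s))) = (1 - Real.exp (-(c * t))) / c := by
  have h : ∀ s, HasDerivAt (fun s => Real.exp (-(c * (t - s))) / c)
      (Real.exp (-(c * (t - s)))) s := by
    intro s
    refine (((((hasDerivAt_id s).const_sub t).const_mul c).neg.exp).div_const c).congr_deriv ?_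
    simp only [id, Pi.neg_apply]
    field_simp
  rw [intervalIntegral.integral_eq_sub_of_hasDerivAt (fun s _ => h s)
    (Continuous.intervalIntegrable (by fun_prop) _ _)]
  simp
  ring

/-- The kernel is at most `√2 exp (-r/2)`, whose integral over `[0, ∞)` is `2√2`; hence a bound
uniform in `t`. -/
lemma sq_integral_mul_le {κ : ℝ → ℝ} (hκ : ∀ r, κ r ^ 2 ≤ 2 * Real.exp (-r)) {F : ℝ}
    (ht : 0 ≤ t) (hF : ∀ s, |f s| ≤ F) :
    (∫ s in (0 : ℝ)..t, κ (t - s) * f s) ^ 2 ≤ 8 * F ^ 2 := by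
  have hF0 : 0 ≤ F := (abs_nonneg _).trans (hF 0)
  have hκ' : ∀ r, |κ r| ≤ √2 * Real.exp (-(1 / 2 * r)) := by
    intro r
    refine abs_le_of_sq_le_sq ?_ (by positivity)
    refine (hκ r).trans (le_of_eq ?_)
    rw [mul_pow, Real.sq_sqrt (by norm_num), ← Real.exp_nat_mul]
    congr 2
    push_cast
    ring
  have h1 : ‖∫ s in (0 : ℝ)..t, κ (t - s) * f s‖
      ≤ ∫ s in (0 : ℝ)..t, √2 * F * Real.exp (-(1 / 2 * (t - s))) := by
    refine intervalIntegral.norm_integral_le_of_norm_le ht (ae_of_all _ fun s _ => ?_)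
      (Continuous.intervalIntegrable (by fun_prop) _ _)
    rw [norm_mul, Real.norm_eq_abs, Real.norm_eq_abs]
    calc |κ (t - s)| * |f s| ≤ (√2 * Real.exp (-(1 / 2 * (t - s)))) * F :=
          mul_le_mul (hκ' _) (hF s) (abs_nonneg _) (by positivity)
      _ = _ := by ring
  rw [intervalIntegral.integral_const_mul, integral_exp_sub t _ (by norm_num)] at h1
  have h2 : ‖∫ s in (0 : ℝ)..t, κ (t - s) * f s‖ ≤ √2 * F * 2 := by
    refine h1.trans (mul_le_mul_of_nonneg_left ?_ (by positivity))
    have := Real.exp_pos (-(1 / 2 * t))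
    rw [div_le_iff₀ (by norm_num)]
    linarith
  rw [← sq_abs, ← Real.norm_eq_abs]
  calc _ ≤ (√2 * F * 2) ^ 2 := by gcongr
    _ = 8 * F ^ 2 := by
        rw [mul_pow, mul_pow, Real.sq_sqrt (by norm_num)]; ring

/-- Duhamel's formula tested against a solution `(p, q)` of the adjoint equation. -/
lemma duhamel_pairing (hu : Continuous u) (hv : Continuous v) (hf : Continuous f)
    (hb : Continuous b) (ht : 0 ≤ t) {a₀ b₀ : ℝ}
    (hpos : ∀ s, 0 ≤ s → u s = a₀ + ∫ r in (0 : ℝ)..s, v r)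
    (hvel : ∀ s, 0 ≤ s → v s = b₀ + (∫ r in (0 : ℝ)..s, (-(m * u r) - v r - f r)) + b s)
    {p q : ℝ → ℝ} (hp : ∀ s, HasDerivAt p (m * q s) s) (hq : ∀ s, HasDerivAt q (q s - p s) s) :
    p t * u t + q t * v t
      = p 0 * a₀ + q 0 * b₀ - (∫ s in (0 : ℝ)..t, q s * f s)
        + wienerIntegral q (fun s => q s - p s) b t := by
  have hcp : Continuous p := continuous_iff_continuousAt.2 fun s => (hp s).continuousAt
  have hcq : Continuous q := continuous_iff_continuousAt.2 fun s => (hq s).continuousAt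
  have hcw : Continuous fun r => -(m * u r) - v r - f r := by fun_prop
  have hU : ∀ s, HasDerivAt (fun s => a₀ + ∫ r in (0 : ℝ)..s, v r) (v s) s := fun s =>
    (intervalIntegral.integral_hasDerivAt_right (hv.intervalIntegrable _ _)
      hv.aestronglyMeasurable.stronglyMeasurableAtFilter hv.continuousAt).const_add a₀
  have hG : ∀ s, HasDerivAt (fun s => b₀ + ∫ r in (0 : ℝ)..s, (-(m * u r) - v r - f r))
      (-(m * u s) - v s - f s) s := fun s =>
    (intervalIntegral.integral_hasDerivAt_right (hcw.intervalIntegrable _ _)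
      hcw.aestronglyMeasurable.stronglyMeasurableAtFilter hcw.continuousAt).const_add b₀
  -- The velocity `v` is only as regular as `b`, but `v - b` is differentiable. Differentiating `p u
  -- + q (v - b)` avoids stochastic calculus, and the adjoint equations cancel all terms in `u` and
  -- `v`.
  have hD : ∀ s ∈ Set.uIcc 0 t, HasDerivAt
      (fun s => p s * (a₀ + ∫ r in (0 : ℝ)..s, v r)
        + q s * (b₀ + ∫ r in (0 : ℝ)..s, (-(m * u r) - v r - f r)))
      (-((q s - p s) * b s) - q s * f s) s := by
    intro s hs
    rw [Set.uIcc_of_le ht] at hs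
    refine (((hp s).mul (hU s)).add ((hq s).mul (hG s))).congr_deriv ?_
    have h1 := hpos s hs.1
    have h2 := hvel s hs.1
    rw [← h1, show b₀ + (∫ r in (0 : ℝ)..s, (-(m * u r) - v r - f r)) = v s - b s by
      linarith]
    ring
  have h := intervalIntegral.integral_eq_sub_of_hasDerivAt hD
    (Continuous.intervalIntegrable (by fun_prop) _ _)
  rw [intervalIntegral.integral_sub (Continuous.intervalIntegrable (by fun_prop) _ _)
    (Continuous.intervalIntegrable (by fun_prop) _ _), intervalIntegral.integral_neg,
    ← hpos t ht, intervalIntegral.integral_same, intervalIntegral.integral_same,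
    show b₀ + (∫ r in (0 : ℝ)..t, (-(m * u r) - v r - f r)) = v t - b t by
      linarith [hvel t ht]] at h
  rw [wienerIntegral]
  linarith

end Duhamel

end SineGordon

/-! ### Pathwise energy estimate for the forced noisy oscillator. -/

namespace SineGordon

noncomputable section

/-- The stochastic convolution `∫₀ᵗ k(t - s) db(s)`. -/
def noisePos (m : ℝ) (b : ℝ → ℝ) (t : ℝ) : ℝ :=
  wienerIntegral (fun s => kernel m (t - s)) (fun s => -kernelDeriv m (t - s)) b t

/-- The stochastic convolution `∫₀ᵗ k'(t - s) db(s)`. -/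
def noiseVel (m : ℝ) (b : ℝ → ℝ) (t : ℝ) : ℝ :=
  wienerIntegral (fun s => kernelDeriv m (t - s))
    (fun s => kernelDeriv m (t - s) + m * kernel m (t - s)) b t

/-- The martingale part of the energy at time `t`, corrected by the dissipation of the free
evolution from `(a₀, b₀)`; it is only needed on `[0, 5]`. -/
def energyFluctuation (m a₀ b₀ : ℝ) (b : ℝ → ℝ) (t : ℝ) : ℝ :=
  if t ≤ 5 then -(∫ s in (0 : ℝ)..t, freeVel m a₀ b₀ s ^ 2)
    + 2 * wienerIntegral (responseWeight m a₀ b₀ t) (responseWeightDeriv m a₀ b₀ t) b t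
  else 0

/-- The factor by which the energy contracts up to time `t`. -/
def contraction (t : ℝ) : ℝ := if t ≤ 5 then 1 else 40 * Real.exp (-t)

end

lemma wienerIntegral_const_mul (φ φ' b : ℝ → ℝ) (c t : ℝ) :
    wienerIntegral φ φ' (fun s => c * b s) t = c * wienerIntegral φ φ' b t := by
  simp only [wienerIntegral, mul_left_comm _ c]
  rw [intervalIntegral.integral_const_mul]
  ring

variable {m : ℝ}

/-- By linearity, the energy pairing of free evolution and noise is one Wiener integral with a
deterministic integrand, so its exponential moments depend only on the integral of the squared
weight. -/
lemma wienerIntegral_responseWeight (hm : 1 ≤ m) {b : ℝ → ℝ} (hb : Continuous b) (a₀ b₀ t : ℝ) :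
    wienerIntegral (responseWeight m a₀ b₀ t) (responseWeightDeriv m a₀ b₀ t) b t
      = m * freePos m a₀ b₀ t * noisePos m b t + freeVel m a₀ b₀ t * noiseVel m b t := by
  have hk := continuous_kernel_sub hm t
  have hh := continuous_kernelDeriv_sub hm t
  have h : ∫ s in (0 : ℝ)..t, responseWeightDeriv m a₀ b₀ t s * b s
      = m * freePos m a₀ b₀ t * (∫ s in (0 : ℝ)..t, -kernelDeriv m (t - s) * b s)
        + freeVel m a₀ b₀ t
          * ∫ s in (0 : ℝ)..t, (kernelDeriv m (t - s) + m * kernel m (t - s)) * b s := by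
    rw [← intervalIntegral.integral_const_mul, ← intervalIntegral.integral_const_mul,
      ← intervalIntegral.integral_add (Continuous.intervalIntegrable (by fun_prop) _ _)
        (Continuous.intervalIntegrable (by fun_prop) _ _)]
    refine intervalIntegral.integral_congr fun s _ => ?_
    simp only [responseWeightDeriv]
    ring
  rw [noisePos, noiseVel, wienerIntegral, wienerIntegral, wienerIntegral, h, responseWeight]
  ring

section Energy

variable {u v f b : ℝ → ℝ} {t a₀ b₀ : ℝ}

lemma duhamel_pos (hm : 1 ≤ m) (hu : Continuous u) (hv : Continuous v) (hf : Continuous f)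
    (hb : Continuous b) (ht : 0 ≤ t)
    (hpos : ∀ s, 0 ≤ s → u s = a₀ + ∫ r in (0 : ℝ)..s, v r)
    (hvel : ∀ s, 0 ≤ s → v s = b₀ + (∫ r in (0 : ℝ)..s, (-(m * u r) - v r - f r)) + b s) :
    u t = freePos m a₀ b₀ t - (∫ s in (0 : ℝ)..t, kernel m (t - s) * f s) + noisePos m b t := by
  have h := duhamel_pairing hu hv hf hb ht hpos hvel
    (p := fun s => kernel m (t - s) + kernelDeriv m (t - s)) (q := fun s => kernel m (t - s))
    (fun s => ((hasDerivAt_kernel_sub hm t s).add (hasDerivAt_kernelDeriv_sub hm t s)).congr_deriv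
      (by ring))
    (fun s => (hasDerivAt_kernel_sub hm t s).congr_deriv (by ring))
  simp only [sub_self, kernel_zero, kernelDeriv_zero, sub_zero, sub_add_cancel_left] at h
  rw [freePos, noisePos]
  linarith

lemma duhamel_vel (hm : 1 ≤ m) (hu : Continuous u) (hv : Continuous v) (hf : Continuous f)
    (hb : Continuous b) (ht : 0 ≤ t)
    (hpos : ∀ s, 0 ≤ s → u s = a₀ + ∫ r in (0 : ℝ)..s, v r)
    (hvel : ∀ s, 0 ≤ s → v s = b₀ + (∫ r in (0 : ℝ)..s, (-(m * u r) - v r - f r)) + b s) :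
    v t = freeVel m a₀ b₀ t - (∫ s in (0 : ℝ)..t, kernelDeriv m (t - s) * f s)
      + noiseVel m b t := by
  have h := duhamel_pairing hu hv hf hb ht hpos hvel
    (p := fun s => -(m * kernel m (t - s))) (q := fun s => kernelDeriv m (t - s))
    (fun s => ((hasDerivAt_kernel_sub hm t s).const_mul m).neg.congr_deriv (by ring))
    (fun s => (hasDerivAt_kernelDeriv_sub hm t s).congr_deriv (by ring))
  simp only [sub_self, kernel_zero, kernelDeriv_zero, sub_zero, sub_neg_eq_add] at h
  rw [freeVel, noiseVel]
  linarith

lemma mul_sq_integral_kernel_le (hm : 1 ≤ m) (ht : 0 ≤ t) {F : ℝ} (hF : ∀ s, |f s| ≤ F) :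
    m * (∫ s in (0 : ℝ)..t, kernel m (t - s) * f s) ^ 2 ≤ 8 * F ^ 2 := by
  have hm0 : 0 ≤ m := by linarith
  have h := sq_integral_mul_le (κ := fun r => √m * kernel m r) (fun r => by
    rw [mul_pow, Real.sq_sqrt hm0]; exact mul_kernel_sq_le hm r) ht hF
  simp_rw [mul_assoc] at h
  rwa [intervalIntegral.integral_const_mul, mul_pow, Real.sq_sqrt hm0] at h

/-- The energy of the forced oscillator, up to terms with exponential moments. -/
lemma energy_le (hm : 1 ≤ m) (hu : Continuous u) (hv : Continuous v) (hf : Continuous f)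
    (hb : Continuous b) (ht : 0 ≤ t) {F : ℝ} (hF : ∀ s, |f s| ≤ F)
    (hpos : ∀ s, 0 ≤ s → u s = a₀ + ∫ r in (0 : ℝ)..s, v r)
    (hvel : ∀ s, 0 ≤ s → v s = b₀ + (∫ r in (0 : ℝ)..s, (-(m * u r) - v r - f r)) + b s) :
    m * u t ^ 2 + v t ^ 2 - contraction t * (m * a₀ ^ 2 + b₀ ^ 2)
      ≤ energyFluctuation m a₀ b₀ b t + 4 * (m * noisePos m b t ^ 2) + 4 * noiseVel m b t ^ 2
        + 2042 * F ^ 2 := by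
  have hm0 : 0 ≤ m := by linarith
  have hk := continuous_kernel_sub hm t
  have hh := continuous_kernelDeriv_sub hm t
  have hU := duhamel_pos hm hu hv hf hb ht hpos hvel
  have hV := duhamel_vel hm hu hv hf hb ht hpos hvel
  have hN1 := mul_sq_integral_kernel_le hm ht hF
  have hN2 := sq_integral_mul_le (κ := kernelDeriv m) (kernelDeriv_sq_le hm) ht hF
  have hW := wienerIntegral_responseWeight hm hb a₀ b₀ t
  have hφf : ∫ s in (0 : ℝ)..t, responseWeight m a₀ b₀ t s * f s
      = m * freePos m a₀ b₀ t * (∫ s in (0 : ℝ)..t, kernel m (t - s) * f s)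
        + freeVel m a₀ b₀ t * ∫ s in (0 : ℝ)..t, kernelDeriv m (t - s) * f s := by
    rw [← intervalIntegral.integral_const_mul, ← intervalIntegral.integral_const_mul,
      ← intervalIntegral.integral_add (Continuous.intervalIntegrable (by fun_prop) _ _)
        (Continuous.intervalIntegrable (by fun_prop) _ _)]
    refine intervalIntegral.integral_congr fun s _ => ?_
    simp only [responseWeight]
    ring
  have hE := free_energy hm a₀ b₀ t
  have hE' := free_energy_le_exp hm a₀ b₀ t
  rw [hU, hV, energyFluctuation, contraction]
  set N1 := ∫ s in (0 : ℝ)..t, kernel m (t - s) * f s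
  set N2 := ∫ s in (0 : ℝ)..t, kernelDeriv m (t - s) * f s
  set Ψ1 := noisePos m b t
  set Ψ2 := noiseVel m b t
  set y := freePos m a₀ b₀ t
  set z := freeVel m a₀ b₀ t
  have hmΨ : 0 ≤ m * Ψ1 ^ 2 := by positivity
  split_ifs with h5
  · have hφ := integral_responseWeight_sq_le hm a₀ b₀ ht h5
    have hcφ := continuous_responseWeight hm a₀ b₀ t
    -- Young's inequality with weight `402`, so that the first term costs exactly one copy of the
    -- dissipation `∫ z²`. With `t ≤ 5` and the forced squares this totals `5 * 402 + 16 + 16 =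
    -- 2042`.
    have hcross : -2 * (∫ s in (0 : ℝ)..t, responseWeight m a₀ b₀ t s * f s)
        ≤ 1 / 402 * (∫ s in (0 : ℝ)..t, responseWeight m a₀ b₀ t s ^ 2) + t * (402 * F ^ 2) := by
      have hconst : t * (402 * F ^ 2) = ∫ _ in (0 : ℝ)..t, 402 * F ^ 2 := by
        simp
        ring
      rw [hconst, ← intervalIntegral.integral_const_mul, ← intervalIntegral.integral_const_mul,
        ← intervalIntegral.integral_add (Continuous.intervalIntegrable (by fun_prop) _ _)
        (Continuous.intervalIntegrable (by fun_prop) _ _)]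
      refine intervalIntegral.integral_mono_on ht (Continuous.intervalIntegrable (by fun_prop) _ _)
        (Continuous.intervalIntegrable (by fun_prop) _ _) fun s _ => ?_
      have h1 : f s ^ 2 ≤ F ^ 2 := sq_le_sq' (neg_le_of_abs_le (hF s)) (le_of_abs_le (hF s))
      nlinarith [sq_nonneg (responseWeight m a₀ b₀ t s + 402 * f s)]
    have hexp : m * (y - N1 + Ψ1) ^ 2 + (z - N2 + Ψ2) ^ 2
        = (m * y ^ 2 + z ^ 2) - 2 * (m * y * N1 + z * N2) + 2 * (m * y * Ψ1 + z * Ψ2)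
          + (m * (Ψ1 - N1) ^ 2 + (Ψ2 - N2) ^ 2) := by ring
    have h1 : m * (Ψ1 - N1) ^ 2 ≤ 2 * (m * Ψ1 ^ 2) + 2 * (m * N1 ^ 2) := by
      nlinarith [mul_nonneg hm0 (sq_nonneg (Ψ1 + N1))]
    have h2 : (Ψ2 - N2) ^ 2 ≤ 2 * Ψ2 ^ 2 + 2 * N2 ^ 2 := by nlinarith [sq_nonneg (Ψ2 + N2)]
    have h3 : t * (402 * F ^ 2) ≤ 5 * (402 * F ^ 2) := by gcongr
    rw [hexp, hE, ← hφf, ← hW]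
    linarith [sq_nonneg Ψ2]
  -- For `t > 5` the cross terms are simply doubled away, turning the decay constant `20` into the
  -- `40` of `contraction`.
  · have h1 : m * (y - N1 + Ψ1) ^ 2 ≤ 2 * (m * y ^ 2) + 4 * (m * N1 ^ 2) + 4 * (m * Ψ1 ^ 2) := by
      nlinarith [mul_nonneg hm0 (sq_nonneg (y - (Ψ1 - N1))), mul_nonneg hm0 (sq_nonneg (Ψ1 + N1))]
    have h2 : (z - N2 + Ψ2) ^ 2 ≤ 2 * z ^ 2 + 4 * N2 ^ 2 + 4 * Ψ2 ^ 2 := by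
      nlinarith [sq_nonneg (z - (Ψ2 - N2)), sq_nonneg (Ψ2 + N2)]
    linarith [sq_nonneg F]

end Energy

lemma integral_sq_kernel_le {κ : ℝ → ℝ} (hc : Continuous κ)
    (hκ : ∀ r, κ r ^ 2 ≤ 2 * Real.exp (-r)) {t : ℝ} (ht : 0 ≤ t) :
    ∫ s in (0 : ℝ)..t, κ (t - s) ^ 2 ≤ 2 := by
  calc _ ≤ ∫ s in (0 : ℝ)..t, 2 * Real.exp (-(1 * (t - s))) := by
        refine intervalIntegral.integral_mono_on ht (Continuous.intervalIntegrable (by fun_prop) _ _)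
          (Continuous.intervalIntegrable (by fun_prop) _ _) fun s _ => ?_
        simpa using hκ (t - s)
    _ ≤ 2 := by
        rw [intervalIntegral.integral_const_mul, integral_exp_sub t 1 one_ne_zero]
        linarith [Real.exp_pos (-(1 * t))]

lemma exp_add_le (x y : ℝ) : Real.exp (x + y) ≤ Real.exp (2 * x) + Real.exp (2 * y) := by
  rcases le_total x y with h | h
  · linarith [Real.exp_pos (2 * x), Real.exp_le_exp.2 (by linarith : x + y ≤ 2 * y)]
  · linarith [Real.exp_pos (2 * y), Real.exp_le_exp.2 (by linarith : x + y ≤ 2 * x)]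

lemma exp_add_add_le (x y z : ℝ) :
    Real.exp (x + y + z) ≤ Real.exp (3 * x) + Real.exp (3 * y) + Real.exp (3 * z) := by
  have hx := Real.exp_pos (3 * x)
  have hy := Real.exp_pos (3 * y)
  have hz := Real.exp_pos (3 * z)
  by_cases h1 : y ≤ x ∧ z ≤ x
  · linarith [Real.exp_le_exp.2 (by linarith : x + y + z ≤ 3 * x)]
  by_cases h2 : x ≤ y ∧ z ≤ y
  · linarith [Real.exp_le_exp.2 (by linarith : x + y + z ≤ 3 * y)]
  have h3 : x ≤ z ∧ y ≤ z := by grind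
  linarith [Real.exp_le_exp.2 (by linarith : x + y + z ≤ 3 * z)]

/-! ### Exponential moments for a single oscillator. -/

section Probability

variable {Ω : Type*} [MeasurableSpace Ω] {P : Measure Ω} {B : ℝ≥0 → Ω → ℝ}

lemma lintegral_exp_sq_wienerIntegral_le [IsProbabilityMeasure P] (hB : IsBrownianReal B P)
    {φ φ' : ℝ → ℝ} (hφ : ∀ s, HasDerivAt φ (φ' s) s) (hφ' : Continuous φ') {T : ℝ} (hT : 0 ≤ T)
    {c : ℝ} (hc : 0 ≤ c) (hcφ : c * ∫ s in (0 : ℝ)..T, φ s ^ 2 ≤ 1 / 4) :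
    ∫⁻ ω, ENNReal.ofReal
      (Real.exp (c * wienerIntegral φ φ' (fun s => B s.toNNReal ω) T ^ 2)) ∂P ≤ 2 :=
  lintegral_exp_sq_le (aemeasurable_wienerIntegral hB hφ hφ' hT)
    (lintegral_exp_wienerIntegral_le hB hφ hφ' hT) hc hcφ

variable [IsProbabilityMeasure P] {σ t μ : ℝ}

/-- The variance of `√m` times the stochastic convolution is at most `2 σ² ≤ 4`, uniformly in `m`
and `t`. The factor `12 = 3 * 4` then gives at most `48 / 5000`, below the threshold `1 / 4`. -/
lemma lintegral_exp_noisePos_le (hB : IsBrownianReal B P) (hm : 1 ≤ m) (hσ : σ ^ 2 ≤ 2)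
    (ht : 0 ≤ t) (hμ : 0 ≤ μ) (hμ' : μ ≤ 1 / 5000) :
    ∫⁻ ω, ENNReal.ofReal (Real.exp
      (3 * (μ * (4 * (m * noisePos m (fun s => σ * B s.toNNReal ω) t ^ 2))))) ∂P ≤ 2 := by
  have h := integral_sq_kernel_le (κ := fun r => √m * kernel m r)
    ((continuous_kernel hm).const_mul _) (fun r => by
      rw [mul_pow, Real.sq_sqrt (by linarith)]; exact mul_kernel_sq_le hm r) ht
  simp_rw [mul_pow, Real.sq_sqrt (by linarith : 0 ≤ m)] at h
  rw [intervalIntegral.integral_const_mul] at h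
  refine le_trans (le_of_eq ?_) (lintegral_exp_sq_wienerIntegral_le hB (hasDerivAt_kernel_sub hm t)
    (continuous_kernelDeriv_sub hm t).neg ht (c := 12 * μ * m * σ ^ 2) (by positivity) ?_)
  · refine lintegral_congr fun ω => ?_
    rw [noisePos, wienerIntegral_const_mul]
    congr 2
    ring
  · have h0 : 0 ≤ m * ∫ s in (0 : ℝ)..t, kernel m (t - s) ^ 2 :=
      mul_nonneg (by linarith) (intervalIntegral.integral_nonneg ht fun _ _ => sq_nonneg _)
    have h1 : μ * σ ^ 2 ≤ 1 / 5000 * 2 := mul_le_mul hμ' hσ (sq_nonneg _) (by norm_num)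
    nlinarith [mul_le_mul h1 h h0 (by norm_num)]

lemma lintegral_exp_noiseVel_le (hB : IsBrownianReal B P) (hm : 1 ≤ m) (hσ : σ ^ 2 ≤ 2)
    (ht : 0 ≤ t) (hμ : 0 ≤ μ) (hμ' : μ ≤ 1 / 5000) :
    ∫⁻ ω, ENNReal.ofReal (Real.exp
      (3 * (μ * (4 * noiseVel m (fun s => σ * B s.toNNReal ω) t ^ 2)))) ∂P ≤ 2 := by
  have h := integral_sq_kernel_le (continuous_kernelDeriv hm) (kernelDeriv_sq_le hm) ht
  refine le_trans (le_of_eq ?_) (lintegral_exp_sq_wienerIntegral_le hB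
    (hasDerivAt_kernelDeriv_sub hm t) ((continuous_kernelDeriv_sub hm t).add
      ((continuous_kernel_sub hm t).const_mul m)) ht (c := 12 * μ * σ ^ 2) (by positivity) ?_)
  · refine lintegral_congr fun ω => ?_
    rw [noiseVel, wienerIntegral_const_mul]
    congr 2
    ring
  · have h0 : 0 ≤ ∫ s in (0 : ℝ)..t, kernelDeriv m (t - s) ^ 2 :=
      intervalIntegral.integral_nonneg ht fun _ _ => sq_nonneg _
    have h1 : μ * σ ^ 2 ≤ 1 / 5000 * 2 := mul_le_mul hμ' hσ (sq_nonneg _) (by norm_num)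
    nlinarith [mul_le_mul h1 h h0 (by norm_num)]

/-- For small `μ` the dissipation of the free evolution compensates the exponential martingale. -/
lemma lintegral_exp_energyFluctuation_le (hB : IsBrownianReal B P) (hm : 1 ≤ m) (hσ : σ ^ 2 ≤ 2)
    (ht : 0 ≤ t) (hμ : 0 ≤ μ) (hμ' : μ ≤ 1 / 5000) (a₀ b₀ : ℝ) :
    ∫⁻ ω, ENNReal.ofReal (Real.exp
      (3 * (μ * energyFluctuation m a₀ b₀ (fun s => σ * B s.toNNReal ω) t))) ∂P ≤ 1 := by
  by_cases h5 : t ≤ 5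
  swap
  · simp [energyFluctuation, h5]
  simp only [energyFluctuation, h5, if_true, wienerIntegral_const_mul]
  set Z := ∫ s in (0 : ℝ)..t, freeVel m a₀ b₀ s ^ 2 with hZ
  have hQ := integral_responseWeight_sq_le hm a₀ b₀ ht h5
  have hφ := lintegral_exp_wienerIntegral_le hB (hasDerivAt_responseWeight hm a₀ b₀ t)
    (continuous_responseWeightDeriv hm a₀ b₀ t) ht (6 * μ * σ)
  have hZ0 : 0 ≤ Z := intervalIntegral.integral_nonneg ht fun _ _ => sq_nonneg _
  have hQ0 : 0 ≤ ∫ s in (0 : ℝ)..t, responseWeight m a₀ b₀ t s ^ 2 :=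
    intervalIntegral.integral_nonneg ht fun _ _ => sq_nonneg _
  have hsplit : ∀ w : ℝ, ENNReal.ofReal (Real.exp (3 * (μ * (-Z + 2 * (σ * w)))))
      = ENNReal.ofReal (Real.exp (-(3 * μ * Z))) * ENNReal.ofReal (Real.exp (6 * μ * σ * w)) := by
    intro w
    rw [← ENNReal.ofReal_mul (Real.exp_pos _).le, ← Real.exp_add]
    congr 2
    ring
  simp_rw [hsplit]
  rw [lintegral_const_mul' _ _ ENNReal.ofReal_ne_top]
  refine (mul_le_mul_right hφ _).trans ?_
  rw [← ENNReal.ofReal_mul (Real.exp_pos _).le, ← Real.exp_add, ENNReal.ofReal_le_one,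
    Real.exp_le_one_iff]
  -- The Gaussian cost `36 * 402 μ² Z` must not exceed the gain `3 μ Z`; this holds up to `μ = 1 /
  -- 4824` and fixes the threshold `1 / 5000`.
  have h1 : (6 * μ * σ) ^ 2 / 2 ≤ 36 * μ ^ 2 := by nlinarith [sq_nonneg μ]
  have h2 := mul_le_mul h1 hQ hQ0 (by positivity)
  have h3 : 36 * μ ^ 2 * (402 * Z) ≤ 3 * μ * Z := by
    nlinarith [mul_nonneg hμ hZ0, mul_le_mul_of_nonneg_right hμ' (mul_nonneg hμ hZ0)]
  linarith

/-- Exponential moments of the energy of a single forced oscillator. -/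
lemma lintegral_exp_oscillator_le (hB : IsBrownianReal B P) (hm : 1 ≤ m) (hσ : σ ^ 2 ≤ 2)
    {u v f : Ω → ℝ → ℝ} {a₀ b₀ F : ℝ}
    (hu : ∀ᵐ ω ∂P, Continuous (u ω)) (hv : ∀ᵐ ω ∂P, Continuous (v ω))
    (hf : ∀ᵐ ω ∂P, Continuous (f ω)) (hF : ∀ᵐ ω ∂P, ∀ s, |f ω s| ≤ F)
    (hpos : ∀ᵐ ω ∂P, ∀ s, 0 ≤ s → u ω s = a₀ + ∫ r in (0 : ℝ)..s, v ω r)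
    (hvel : ∀ᵐ ω ∂P, ∀ s, 0 ≤ s → v ω s
      = b₀ + (∫ r in (0 : ℝ)..s, (-(m * u ω r) - v ω r - f ω r)) + σ * B s.toNNReal ω)
    (ht : 0 ≤ t) (hμ : 0 ≤ μ) (hμ' : μ ≤ 1 / 5000) :
    ∫⁻ ω, ENNReal.ofReal (Real.exp
      (μ * (m * u ω t ^ 2 + v ω t ^ 2 - contraction t * (m * a₀ ^ 2 + b₀ ^ 2)))) ∂P
      ≤ ENNReal.ofReal (5 * Real.exp (2042 * F ^ 2)) := by
  let X₁ : Ω → ℝ := fun ω => 3 * (μ * energyFluctuation m a₀ b₀ (fun s => σ * B s.toNNReal ω) t)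
  let X₂ : Ω → ℝ := fun ω => 3 * (μ * (4 * (m * noisePos m (fun s => σ * B s.toNNReal ω) t ^ 2)))
  let X₃ : Ω → ℝ := fun ω => 3 * (μ * (4 * noiseVel m (fun s => σ * B s.toNNReal ω) t ^ 2))
  have hX₁ : AEMeasurable X₁ P := by
    have h := aemeasurable_wienerIntegral hB (hasDerivAt_responseWeight hm a₀ b₀ t)
      (continuous_responseWeightDeriv hm a₀ b₀ t) ht
    simp only [X₁, energyFluctuation, wienerIntegral_const_mul]
    split_ifs <;> fun_prop
  have hX₂ : AEMeasurable X₂ P := by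
    have h := aemeasurable_wienerIntegral hB (hasDerivAt_kernel_sub hm t)
      (continuous_kernelDeriv_sub hm t).neg ht
    simp only [X₂, noisePos, wienerIntegral_const_mul]
    exact ((((h.const_mul _).pow_const 2).const_mul _).const_mul _).const_mul _ |>.const_mul _
  have hle : ∀ᵐ ω ∂P, ENNReal.ofReal (Real.exp
      (μ * (m * u ω t ^ 2 + v ω t ^ 2 - contraction t * (m * a₀ ^ 2 + b₀ ^ 2))))
      ≤ ENNReal.ofReal (Real.exp (2042 * F ^ 2)) * (ENNReal.ofReal (Real.exp (X₁ ω))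
        + ENNReal.ofReal (Real.exp (X₂ ω)) + ENNReal.ofReal (Real.exp (X₃ ω))) := by
    filter_upwards [hu, hv, hf, hF, hpos, hvel, hB.cont] with ω h1 h2 h3 h4 h5 h6 h7
    have hE := energy_le hm h1 h2 h3 ((h7.comp continuous_real_toNNReal).const_mul σ) ht h4 h5 h6
    rw [← ENNReal.ofReal_add (Real.exp_pos _).le (Real.exp_pos _).le,
      ← ENNReal.ofReal_add (by positivity) (Real.exp_pos _).le,
      ← ENNReal.ofReal_mul (Real.exp_pos _).le]
    refine ENNReal.ofReal_le_ofReal (le_trans ?_ (mul_le_mul_of_nonneg_left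
      (exp_add_add_le _ _ _) (Real.exp_pos _).le))
    rw [← Real.exp_add, Real.exp_le_exp]
    have hμF : μ * (2042 * F ^ 2) ≤ 2042 * F ^ 2 :=
      mul_le_of_le_one_left (by positivity) (by linarith)
    have := mul_le_mul_of_nonneg_left hE hμ
    simp only [Function.comp_apply] at this
    linarith
  refine (lintegral_mono_ae hle).trans ?_
  rw [lintegral_const_mul' _ _ ENNReal.ofReal_ne_top,
    lintegral_add_left' (by fun_prop), lintegral_add_left' (by fun_prop), mul_comm 5, ENNReal.ofReal_mul (Real.exp_pos _).le]
  refine mul_le_mul_right ?_ _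
  -- The three contributions are `1 + 2 + 2 = 5`.
  refine (add_le_add (add_le_add (lintegral_exp_energyFluctuation_le hB hm hσ ht hμ hμ' a₀ b₀)
    (lintegral_exp_noisePos_le hB hm hσ ht hμ hμ')) (lintegral_exp_noiseVel_le hB hm hσ ht hμ hμ'
    )).trans (le_of_eq ?_)
  rw [ENNReal.ofReal_ofNat]
  norm_num

end Probability

/-! ### Sobolev coefficients, and boundedness and continuity of the nonlinearity. -/

lemma one_le_bracket (n : ℤ) : 1 ≤ bracket n :=
  Real.one_le_sqrt.2 (by nlinarith [sq_nonneg (n : ℝ)])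

lemma bracket_sq (n : ℤ) : bracket n ^ 2 = 1 + (n : ℝ) ^ 2 := Real.sq_sqrt (by positivity)

namespace Sobolev

variable {s : ℝ}

lemma summable_norm_sq (a : Sobolev s) :
    Summable fun n : ℤ => bracket n ^ (2 * s) * ‖a.coeff n‖ ^ 2 := by
  have h := (memℓp_gen_iff (p := 2) (by norm_num)).1 a.2.2
  refine h.congr fun n => ?_
  have h2 : weighted s a.1 n = (bracket n ^ s) • a.coeff n := rfl
  rw [h2, norm_smul, Real.norm_of_nonneg (Real.rpow_nonneg (bracket_pos n).le s),
    ENNReal.toReal_ofNat, Real.rpow_ofNat, mul_pow, ← Real.rpow_natCast,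
    ← Real.rpow_mul (bracket_pos n).le]
  norm_num [mul_comm]

lemma norm_coeff_sq_le (hs : 0 ≤ s) (a : Sobolev s) (n : ℤ) :
    ‖a.coeff n‖ ^ 2 ≤ bracket n ^ (2 * s) * ‖a.coeff n‖ ^ 2 :=
  le_mul_of_one_le_left (sq_nonneg _) (Real.one_le_rpow (one_le_bracket n) (by linarith))

lemma memℓp_coeff (hs : 0 ≤ s) (a : Sobolev s) : Memℓp a.coeff 2 := by
  refine memℓp_gen (Summable.of_nonneg_of_le (fun n => by positivity) (fun n => ?_)
    (summable_norm_sq a))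
  rw [ENNReal.toReal_ofNat, Real.rpow_ofNat]
  exact norm_coeff_sq_le hs a n

/-- For `s ≥ 0` the coefficients are square summable, so the `tsum` is a genuine `L²` sum and
Parseval applies. -/
lemma toL2_coeff (hs : 0 ≤ s) (a : Sobolev s) :
    toL2 a.coeff = (fourierBasis (T := 2 * Real.pi)).repr.symm ⟨a.coeff, memℓp_coeff hs a⟩ := by
  have h := (fourierBasis (T := 2 * Real.pi)).hasSum_repr_symm ⟨a.coeff, memℓp_coeff hs a⟩
  rw [coe_fourierBasis] at h
  exact h.tsum_eq

lemma norm_toL2_sub_le (hs : 0 ≤ s) (a b : Sobolev s) :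
    ‖toL2 a.coeff - toL2 b.coeff‖ ≤ ‖a - b‖ := by
  rw [toL2_coeff hs, toL2_coeff hs, ← map_sub, LinearIsometryEquiv.norm_map]
  have h : (⟨a.coeff, memℓp_coeff hs a⟩ - ⟨b.coeff, memℓp_coeff hs b⟩ : lp (fun _ : ℤ => ℂ) 2)
      = ⟨(a - b).coeff, memℓp_coeff hs (a - b)⟩ := rfl
  rw [h]
  refine le_of_sq_le_sq ?_ (norm_nonneg _)
  have h1 := lp.norm_rpow_eq_tsum (p := 2) (by norm_num)
    (⟨(a - b).coeff, memℓp_coeff hs (a - b)⟩ : lp (fun _ : ℤ => ℂ) 2)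
  simp only [ENNReal.toReal_ofNat, Real.rpow_ofNat] at h1
  rw [h1, norm_sq_eq]
  exact Summable.tsum_le_tsum (norm_coeff_sq_le hs _) (Summable.of_nonneg_of_le
    (fun n => by positivity) (norm_coeff_sq_le hs _) (summable_norm_sq _)) (summable_norm_sq _)

lemma continuous_coeff (n : ℤ) : Continuous fun a : Sobolev s => a.coeff n := by
  have hb : 0 < bracket n ^ s := Real.rpow_pos_of_pos (bracket_pos n) s
  have h : LipschitzWith (Real.toNNReal (bracket n ^ s)⁻¹) fun a : Sobolev s => a.coeff n := by
    refine LipschitzWith.of_dist_le_mul fun a b => ?_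
    rw [Real.coe_toNNReal _ (by positivity), dist_eq_norm, dist_eq_norm, le_inv_mul_iff₀ hb]
    have h1 := lp.norm_apply_le_norm (by norm_num) (toEll2 s (a - b)) n
    have h2 : (toEll2 s (a - b)) n = (bracket n ^ s) • (a.coeff n - b.coeff n) := rfl
    rw [h2, norm_smul, Real.norm_of_nonneg hb.le] at h1
    exact h1
  exact h.continuous

end Sobolev

lemma norm_fourier_apply (n : ℤ) (x : Torus) : ‖fourier n x‖ = 1 := by
  rw [fourier_apply]
  exact Circle.norm_coe _

lemma norm_sinCoeff_le (β : ℝ) (a : ℤ → ℂ) (n : ℤ) : ‖sinCoeff β a n‖ ≤ 1 := by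
  rw [sinCoeff, fourierCoeff]
  refine (norm_integral_le_of_norm_le_const (C := 1) (ae_of_all _ fun x => ?_)).trans (by simp)
  rw [norm_smul, Complex.norm_real]
  rw [norm_fourier_apply, one_mul]
  exact Real.abs_sin_le_one _

/-- Sine is `1`-Lipschitz and `L² ⊂ L¹` with constant `1` for a probability measure. It serves to
make the force continuous along paths, as Duhamel's formula requires. -/
lemma norm_sinCoeff_sub_le (β : ℝ) (a b : ℤ → ℂ) (n : ℤ) :
    ‖sinCoeff β a n - sinCoeff β b n‖ ≤ |β| * ‖toL2 a - toL2 b‖ := by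
  have hint : ∀ c : ℤ → ℂ, Integrable (fun x : Torus => fourier (-n) x •
      ((Real.sin (β * (toL2 c x).re) : ℝ) : ℂ)) AddCircle.haarAddCircle := by
    intro c
    have hm : AEStronglyMeasurable (fun x : Torus => ((Real.sin (β * (toL2 c x).re) : ℝ) : ℂ))
        AddCircle.haarAddCircle := by
      have h1 := Lp.aestronglyMeasurable (toL2 c)
      have h2 : Continuous fun z : ℂ => ((Real.sin (β * z.re) : ℝ) : ℂ) := by fun_prop
      exact h2.comp_aestronglyMeasurable h1
    refine Integrable.of_bound ((fourier (-n)).continuous.aestronglyMeasurable.smul hm) 1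
      (ae_of_all _ fun x => ?_)
    rw [norm_smul, Complex.norm_real]
    rw [norm_fourier_apply, one_mul]
    exact Real.abs_sin_le_one _
  rw [← toReal_enorm, ← toReal_enorm, ← abs_abs, ← Real.norm_eq_abs, ← toReal_enorm,
    ← ENNReal.toReal_mul]
  refine ENNReal.toReal_mono (ENNReal.mul_ne_top enorm_ne_top enorm_ne_top) ?_
  rw [sinCoeff, sinCoeff, fourierCoeff, fourierCoeff, ← integral_sub (hint a) (hint b)]
  calc _ ≤ ∫⁻ x : Torus, ‖|β|‖ₑ * ‖(toL2 a - toL2 b) x‖ₑ ∂AddCircle.haarAddCircle := by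
        refine (enorm_integral_le_lintegral_enorm _).trans (lintegral_mono_ae ?_)
        filter_upwards [Lp.coeFn_sub (toL2 a) (toL2 b)] with x hx
        rw [hx, Pi.sub_apply, ← ofReal_norm, ← ofReal_norm, ← ofReal_norm,
          ← ENNReal.ofReal_mul (norm_nonneg _)]
        refine ENNReal.ofReal_le_ofReal ?_
        rw [← smul_sub, norm_smul, ← Complex.ofReal_sub, Complex.norm_real]
        rw [norm_fourier_apply, one_mul, Real.norm_eq_abs, Real.norm_eq_abs, abs_abs]
        refine (Real.abs_sin_sub_sin_le _ _).trans ?_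
        rw [← mul_sub, abs_mul, ← Complex.sub_re]
        exact mul_le_mul_of_nonneg_left (Complex.abs_re_le_norm _) (abs_nonneg _)
    _ = ‖|β|‖ₑ * eLpNorm (toL2 a - toL2 b : Lp ℂ 2 (AddCircle.haarAddCircle : Measure Torus)) 1
          AddCircle.haarAddCircle := by
        rw [lintegral_const_mul' _ _ enorm_ne_top, eLpNorm_one_eq_lintegral_enorm]
    _ ≤ ‖|β|‖ₑ * ‖toL2 a - toL2 b‖ₑ := by
        rw [Lp.enorm_def]
        gcongr
        exact eLpNorm_le_eLpNorm_of_exponent_le (by norm_num) (Lp.aestronglyMeasurable _)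

lemma continuous_sinCoeff (β : ℝ) {s : ℝ} (hs : 0 ≤ s) (n : ℤ) :
    Continuous fun a : Sobolev s => sinCoeff β a.coeff n := by
  have h : LipschitzWith (Real.toNNReal |β|) fun a : Sobolev s => sinCoeff β a.coeff n := by
    refine LipschitzWith.of_dist_le_mul fun a b => ?_
    rw [Real.coe_toNNReal _ (abs_nonneg _), dist_eq_norm, dist_eq_norm]
    exact (norm_sinCoeff_sub_le β _ _ n).trans
      (mul_le_mul_of_nonneg_left (Sobolev.norm_toL2_sub_le hs a b) (abs_nonneg _))
  exact h.continuous

/-! ### From Fourier modes to real oscillators. -/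

section Noise

variable {Ω : Type*}

/-- Each part of a complex mode is a scaled single Brownian motion, with scale `1` or `1/√2`; with
the factor `√2` of the equation this gives `σ² ≤ 2`. -/
lemma exists_re_noiseMode (W : ℤ → ℝ≥0 → Ω → ℝ) (n : ℤ) :
    ∃ (c : ℝ) (j : ℤ), c ^ 2 ≤ 1 ∧ ∀ t ω, Complex.reCLM (noiseMode W n t ω) = c * W j t ω := by
  have h2 : ((√2)⁻¹) ^ 2 ≤ (1 : ℝ) := by rw [inv_pow, Real.sq_sqrt (by norm_num)]; norm_num
  rcases lt_trichotomy n 0 with h | rfl | h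
  · refine ⟨(√2)⁻¹, -n, h2, fun t ω => ?_⟩
    rw [noiseMode, if_neg h.ne, if_neg h.not_gt, Complex.reCLM_apply, Complex.div_ofReal_re]
    simp
    ring
  · exact ⟨1, 0, by norm_num, fun t ω => by simp [noiseMode]⟩
  · refine ⟨(√2)⁻¹, n, h2, fun t ω => ?_⟩
    rw [noiseMode, if_neg h.ne', if_pos h, Complex.reCLM_apply, Complex.div_ofReal_re]
    simp
    ring

lemma exists_im_noiseMode (W : ℤ → ℝ≥0 → Ω → ℝ) (n : ℤ) :
    ∃ (c : ℝ) (j : ℤ), c ^ 2 ≤ 1 ∧ ∀ t ω, Complex.imCLM (noiseMode W n t ω) = c * W j t ω := by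
  have h2 : ((√2)⁻¹) ^ 2 ≤ (1 : ℝ) := by rw [inv_pow, Real.sq_sqrt (by norm_num)]; norm_num
  rcases lt_trichotomy n 0 with h | rfl | h
  · refine ⟨-(√2)⁻¹, n, by rwa [neg_sq], fun t ω => ?_⟩
    rw [noiseMode, if_neg h.ne, if_neg h.not_gt, Complex.imCLM_apply, Complex.div_ofReal_im]
    simp
    ring
  · exact ⟨0, 0, by norm_num, fun t ω => by simp [noiseMode]⟩
  · refine ⟨(√2)⁻¹, -n, h2, fun t ω => ?_⟩
    rw [noiseMode, if_neg h.ne', if_pos h, Complex.imCLM_apply, Complex.div_ofReal_im]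
    simp
    ring

end Noise

section Modes

variable {Ω : Type*} [MeasurableSpace Ω] {P : Measure Ω} [IsProbabilityMeasure P]
  {W : ℤ → ℝ≥0 → Ω → ℝ} {γ β α : ℝ} {u₀ : PhaseSpace α} {Φ : ℝ≥0 → Ω → PhaseSpace α}

/-- Exponential moments of the energy of the real or imaginary part of a Fourier mode. -/
lemma lintegral_exp_mode_part_le (hα : 0 ≤ α) (hW : IsCylindricalWiener P W)
    (hΦ : IsSolution P W γ β u₀ Φ) (n : ℤ) (L : ℂ →L[ℝ] ℝ) (hL : ∀ z, |L z| ≤ ‖z‖)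
    (hLW : ∃ (c : ℝ) (j : ℤ), c ^ 2 ≤ 1 ∧ ∀ t ω, L (noiseMode W n t ω) = c * W j t ω)
    (t : ℝ≥0) {μ : ℝ} (hμ : 0 ≤ μ) (hμ' : μ ≤ 1 / 5000) :
    ∫⁻ ω, ENNReal.ofReal (Real.exp (μ * ((1 + (n : ℝ) ^ 2) * L ((Φ t ω).fst.coeff n) ^ 2
        + L ((Φ t ω).snd.coeff n) ^ 2 - contraction t *
          ((1 + (n : ℝ) ^ 2) * L (u₀.fst.coeff n) ^ 2 + L (u₀.snd.coeff n) ^ 2)))) ∂P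
      ≤ ENNReal.ofReal (5 * Real.exp (2042 * |γ| ^ 2)) := by
  obtain ⟨c, j, hc, hcj⟩ := hLW
  have hσ : (√2 * c) ^ 2 ≤ 2 := by
    rw [mul_pow, Real.sq_sqrt (by norm_num)]; linarith
  have hcu : ∀ᵐ ω ∂P, Continuous fun s : ℝ => (Φ s.toNNReal ω).fst.coeff n := by
    filter_upwards [hΦ.continuous_paths] with ω h
    exact (Sobolev.continuous_coeff n).comp
      ((WithLp.continuous_fst 2 _ _).comp (h.comp continuous_real_toNNReal))
  have hcv : ∀ᵐ ω ∂P, Continuous fun s : ℝ => (Φ s.toNNReal ω).snd.coeff n := by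
    filter_upwards [hΦ.continuous_paths] with ω h
    exact (Sobolev.continuous_coeff n).comp
      ((WithLp.continuous_snd 2 _ _).comp (h.comp continuous_real_toNNReal))
  have hcf : ∀ᵐ ω ∂P, Continuous fun s : ℝ => sinCoeff β (Φ s.toNNReal ω).fst.coeff n := by
    filter_upwards [hΦ.continuous_paths] with ω h
    exact (continuous_sinCoeff β hα n).comp
      ((WithLp.continuous_fst 2 _ _).comp (h.comp continuous_real_toNNReal))
  -- The linear coefficients are real, so a real functional `L` turns the mode equation into a real
  -- oscillator whose force `γ L (sinCoeff ..)` is bounded by `|γ|`.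
  have h := lintegral_exp_oscillator_le (P := P) (hW.brownian j) (m := 1 + (n : ℝ) ^ 2)
    (by nlinarith [sq_nonneg (n : ℝ)]) hσ (t := t) (μ := μ) (F := |γ|)
    (u := fun ω s => L ((Φ s.toNNReal ω).fst.coeff n))
    (v := fun ω s => L ((Φ s.toNNReal ω).snd.coeff n))
    (f := fun ω s => γ * L (sinCoeff β (Φ s.toNNReal ω).fst.coeff n))
    (a₀ := L (u₀.fst.coeff n)) (b₀ := L (u₀.snd.coeff n))
    (hcu.mono fun ω h => L.continuous.comp h) (hcv.mono fun ω h => L.continuous.comp h)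
    (hcf.mono fun ω h => (L.continuous.comp h).const_mul γ) (ae_of_all _ fun ω s => ?_) ?_ ?_
    t.2 hμ hμ'
  · simpa using h
  · rw [abs_mul]
    exact mul_le_of_le_one_right (abs_nonneg _) ((hL _).trans (norm_sinCoeff_le _ _ _))
  · filter_upwards [hcv, hΦ.position] with ω h1 h2 s hs
    have h3 := congrArg L (h2 n s.toNNReal)
    rwa [map_add, ← L.intervalIntegral_comp_comm (h1.intervalIntegrable _ _),
      Real.coe_toNNReal s hs] at h3
  · filter_upwards [hcu, hcv, hcf, hΦ.momentum] with ω h1 h2 h3 h4 s hs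
    have h5 := congrArg L (h4 n s.toNNReal)
    rw [map_add, map_add, ← L.intervalIntegral_comp_comm
      (Continuous.intervalIntegrable (by fun_prop) _ _), Real.coe_toNNReal s hs] at h5
    rw [h5]
    congr 1
    · congr 1
      refine intervalIntegral.integral_congr fun r _ => ?_
      rw [map_sub, map_sub, show -(1 + (n : ℂ) ^ 2) = ((-(1 + (n : ℝ) ^ 2) : ℝ) : ℂ) by simp,
        ← Complex.real_smul, ← Complex.real_smul, map_smul, map_smul, smul_eq_mul, smul_eq_mul,
        neg_mul]
    · rw [← Complex.real_smul, map_smul, hcj, smul_eq_mul, mul_assoc]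

/-- The excess at time `t` of the energy of the `n`-th Fourier mode over its contracted initial
value. -/
noncomputable def modeExcess (u₀ : PhaseSpace α) (t : ℝ) (n : ℤ) (x : PhaseSpace α) : ℝ :=
  (1 + (n : ℝ) ^ 2) * ‖x.fst.coeff n‖ ^ 2 + ‖x.snd.coeff n‖ ^ 2
    - contraction t * ((1 + (n : ℝ) ^ 2) * ‖u₀.fst.coeff n‖ ^ 2 + ‖u₀.snd.coeff n‖ ^ 2)

lemma continuous_fst_coeff (n : ℤ) : Continuous fun x : PhaseSpace α => x.fst.coeff n :=
  (Sobolev.continuous_coeff n).comp (WithLp.continuous_fst 2 _ _)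

lemma continuous_snd_coeff (n : ℤ) : Continuous fun x : PhaseSpace α => x.snd.coeff n :=
  (Sobolev.continuous_coeff n).comp (WithLp.continuous_snd 2 _ _)

lemma continuous_modeExcess (u₀ : PhaseSpace α) (t : ℝ) (n : ℤ) :
    Continuous (modeExcess u₀ t n) := by
  have h1 := continuous_fst_coeff (α := α) n
  have h2 := continuous_snd_coeff (α := α) n
  unfold modeExcess
  fun_prop

/-- Exponential moments of the energy of a Fourier mode. -/
lemma lintegral_exp_modeExcess_le (hα : 0 ≤ α) (hW : IsCylindricalWiener P W)
    (hΦ : IsSolution P W γ β u₀ Φ) (n : ℤ) (t : ℝ≥0) {μ : ℝ} (hμ : 0 ≤ μ)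
    (hμ' : μ ≤ 1 / 10000) :
    ∫⁻ ω, ENNReal.ofReal (Real.exp (μ * modeExcess u₀ t n (Φ t ω))) ∂P
      ≤ ENNReal.ofReal (10 * Real.exp (2042 * |γ| ^ 2)) := by
  -- The parameter is doubled because `exp (x + y)` is bounded by `exp (2x) + exp (2y)`; this halves
  -- the threshold to `1 / 10000`.
  have hre := lintegral_exp_mode_part_le hα hW hΦ n Complex.reCLM Complex.abs_re_le_norm
    (exists_re_noiseMode W n) t (μ := 2 * μ) (by linarith) (by linarith)
  have him := lintegral_exp_mode_part_le hα hW hΦ n Complex.imCLM Complex.abs_im_le_norm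
    (exists_im_noiseMode W n) t (μ := 2 * μ) (by linarith) (by linarith)
  have hsum := add_le_add hre him
  rw [← ENNReal.ofReal_add (by positivity) (by positivity), ← lintegral_add_left'] at hsum
  · refine le_trans (lintegral_mono fun ω => ?_) (hsum.trans (le_of_eq (by congr 1; ring)))
    rw [← ENNReal.ofReal_add (Real.exp_pos _).le (Real.exp_pos _).le]
    rw [mul_assoc 2 μ, mul_assoc 2 μ]
    refine ENNReal.ofReal_le_ofReal (le_trans (le_of_eq ?_) (exp_add_le _ _))
    rw [modeExcess, Complex.sq_norm, Complex.sq_norm, Complex.sq_norm, Complex.sq_norm]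
    simp only [Complex.normSq_apply, Complex.reCLM_apply, Complex.imCLM_apply]
    congr 1
    ring
  · have h1 := continuous_fst_coeff (α := α) n
    have h2 := continuous_snd_coeff (α := α) n
    have hc : Continuous fun x : PhaseSpace α => Real.exp (2 * μ * ((1 + (n : ℝ) ^ 2)
        * Complex.reCLM (x.fst.coeff n) ^ 2 + Complex.reCLM (x.snd.coeff n) ^ 2 - contraction t *
          ((1 + (n : ℝ) ^ 2) * Complex.reCLM (u₀.fst.coeff n) ^ 2
            + Complex.reCLM (u₀.snd.coeff n) ^ 2))) := by
      fun_prop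
    exact (hc.comp_aestronglyMeasurable (hΦ.measurable t)).aemeasurable.ennreal_ofReal

end Modes

/-! ### Summation over the modes by convexity. -/

lemma summable_bracket_rpow {s : ℝ} (hs : s < -1) : Summable fun n : ℤ => bracket n ^ s := by
  have h := Real.summable_abs_int_rpow (b := -s) (by linarith)
  rw [neg_neg] at h
  refine h.of_norm_bounded_eventually ?_
  refine (Set.finite_singleton (0 : ℤ)).subset fun n hn => ?_
  by_contra h0
  refine hn ?_
  have hpos : 0 < |(n : ℝ)| := abs_pos.2 (by exact_mod_cast h0)
  change ‖bracket n ^ s‖ ≤ |(n : ℝ)| ^ s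
  rw [Real.norm_of_nonneg (Real.rpow_nonneg (bracket_pos n).le _)]
  refine Real.rpow_le_rpow_of_nonpos hpos ?_ (by linarith)
  refine Real.abs_le_sqrt ?_
  linarith

/-- Jensen's inequality for the exponential and a countable family of weights. -/
lemma ofReal_exp_le_tsum {ι : Type*} {p x : ι → ℝ} {M : ℝ} (hp : ∀ i, 0 ≤ p i) (hp1 : HasSum p 1)
    (hM : HasSum (fun i => p i * x i) M) :
    ENNReal.ofReal (Real.exp M) ≤ ∑' i, ENNReal.ofReal (p i) * ENNReal.ofReal (Real.exp (x i)) := by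
  by_cases htop : ∑' i, ENNReal.ofReal (p i) * ENNReal.ofReal (Real.exp (x i)) = ⊤
  · simp [htop]
  simp_rw [← ENNReal.ofReal_mul (hp _)] at htop ⊢
  have hnn : ∀ i, 0 ≤ p i * Real.exp (x i) := fun i => mul_nonneg (hp i) (Real.exp_pos _).le
  have hs : Summable fun i => p i * Real.exp (x i) :=
    (ENNReal.summable_toReal htop).congr fun i => ENNReal.toReal_ofReal (hnn i)
  rw [← ENNReal.ofReal_tsum_of_nonneg hnn hs]
  refine ENNReal.ofReal_le_ofReal ?_
  -- The tangent line of `exp` at the mean `M` lies below `exp`, and its `p`-average is `exp M`.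
  have h1 : HasSum (fun i => Real.exp M * ((1 - M) * p i + p i * x i))
      (Real.exp M * ((1 - M) * 1 + M)) := ((hp1.mul_left _).add hM).mul_left _
  have h2 : Real.exp M * ((1 - M) * 1 + M) = Real.exp M := by ring
  rw [h2] at h1
  refine hasSum_le (fun i => ?_) h1 hs.hasSum
  have h3 := Real.add_one_le_exp (x i - M)
  have h4 : Real.exp (x i) = Real.exp M * Real.exp (x i - M) := by
    rw [← Real.exp_add]; congr 1; ring
  have h5 := mul_nonneg (hp i) (Real.exp_pos M).le
  rw [h4]
  nlinarith

section Norm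

variable {α : ℝ}

/-- Since `⟨n⟩^(2α) = ⟨n⟩^(2(α-1)) (1 + n²)`, both components share one weight and the norm is a
weighted sum of mode energies. -/
lemma hasSum_norm_sq (x : PhaseSpace α) :
    HasSum (fun n : ℤ => bracket n ^ (2 * (α - 1)) *
      ((1 + (n : ℝ) ^ 2) * ‖x.fst.coeff n‖ ^ 2 + ‖x.snd.coeff n‖ ^ 2)) (‖x‖ ^ 2) := by
  rw [WithLp.prod_norm_sq_eq_of_L2, Sobolev.norm_sq_eq, Sobolev.norm_sq_eq]
  refine ((Sobolev.summable_norm_sq x.fst).hasSum.add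
    (Sobolev.summable_norm_sq x.snd).hasSum).congr_fun fun n => ?_
  have h : bracket n ^ (2 * α) = bracket n ^ (2 * (α - 1)) * (1 + (n : ℝ) ^ 2) := by
    rw [← bracket_sq, ← Real.rpow_natCast, ← Real.rpow_add (bracket_pos n)]
    congr 1
    push_cast
    ring
  rw [h]
  ring

lemma hasSum_modeExcess (u₀ x : PhaseSpace α) (t : ℝ) :
    HasSum (fun n : ℤ => bracket n ^ (2 * (α - 1)) * modeExcess u₀ t n x)
      (‖x‖ ^ 2 - contraction t * ‖u₀‖ ^ 2) := by
  refine ((hasSum_norm_sq x).sub ((hasSum_norm_sq u₀).mul_left (contraction t))).congr_fun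
    fun n => ?_
  rw [modeExcess]
  ring

end Norm

section Moments

variable {Ω : Type*} [MeasurableSpace Ω] {P : Measure Ω} [IsProbabilityMeasure P]
  {W : ℤ → ℝ≥0 → Ω → ℝ} {γ β α : ℝ} {u₀ : PhaseSpace α} {Φ : ℝ≥0 → Ω → PhaseSpace α}

/-- Exponential moments of the excess of the squared norm over its contracted initial value. -/
lemma lintegral_exp_norm_sq_sub_le (hα : 0 ≤ α) (hα' : α < 1 / 2) (hW : IsCylindricalWiener P W)
    (hΦ : IsSolution P W γ β u₀ Φ) (t : ℝ≥0) {μ : ℝ} (hμ : 0 ≤ μ)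
    (hμ' : μ * ∑' n : ℤ, bracket n ^ (2 * (α - 1)) ≤ 1 / 10000) :
    ∫⁻ ω, ENNReal.ofReal (Real.exp (μ * (‖Φ t ω‖ ^ 2 - contraction t * ‖u₀‖ ^ 2))) ∂P
      ≤ ENNReal.ofReal (10 * Real.exp (2042 * |γ| ^ 2)) := by
  have hsum := summable_bracket_rpow (s := 2 * (α - 1)) (by linarith)
  have hw : ∀ n : ℤ, 0 < bracket n ^ (2 * (α - 1)) := fun n => Real.rpow_pos_of_pos (bracket_pos n) _
  set S := ∑' n : ℤ, bracket n ^ (2 * (α - 1)) with hS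
  have hS0 : 0 < S := hsum.tsum_pos (fun n => (hw n).le) 0 (hw 0)
  have hp : ∀ n : ℤ, 0 ≤ bracket n ^ (2 * (α - 1)) / S := fun n => div_nonneg (hw n).le hS0.le
  have hp1 : HasSum (fun n : ℤ => bracket n ^ (2 * (α - 1)) / S) 1 := by
    have := hsum.hasSum.div_const S
    rwa [← hS, div_self hS0.ne'] at this
  -- Normalizing the weights by `S` multiplies the parameter of each mode by `S`; hence the
  -- smallness condition on `μ * S`.
  have hpt : ∀ ω, ENNReal.ofReal (Real.exp (μ * (‖Φ t ω‖ ^ 2 - contraction t * ‖u₀‖ ^ 2)))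
      ≤ ∑' n : ℤ, ENNReal.ofReal (bracket n ^ (2 * (α - 1)) / S)
        * ENNReal.ofReal (Real.exp (μ * S * modeExcess u₀ t n (Φ t ω))) := fun ω =>
    ofReal_exp_le_tsum hp hp1 (((hasSum_modeExcess u₀ (Φ t ω) t).mul_left μ).congr_fun fun n => by
      field_simp)
  refine (lintegral_mono hpt).trans ?_
  rw [lintegral_tsum fun n => ?_]
  · calc _ ≤ ∑' n : ℤ, ENNReal.ofReal (bracket n ^ (2 * (α - 1)) / S)
          * ENNReal.ofReal (10 * Real.exp (2042 * |γ| ^ 2)) := by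
          refine ENNReal.tsum_le_tsum fun n => ?_
          rw [lintegral_const_mul' _ _ ENNReal.ofReal_ne_top]
          exact mul_le_mul_right (lintegral_exp_modeExcess_le hα hW hΦ n t (by positivity) hμ') _
      _ = _ := by
          rw [ENNReal.tsum_mul_right, ← ENNReal.ofReal_tsum_of_nonneg hp hp1.summable,
            hp1.tsum_eq, ENNReal.ofReal_one, one_mul]
  · exact (((Real.continuous_exp.comp ((continuous_modeExcess u₀ t n).const_mul
      (μ * S))).comp_aestronglyMeasurable (hΦ.measurable t)).aemeasurable.ennreal_ofReal).const_mul _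

lemma integrable_exp_norm_sq_and_integral_le (hα : 0 ≤ α) (hα' : α < 1 / 2)
    (hW : IsCylindricalWiener P W) (hΦ : IsSolution P W γ β u₀ Φ) (t : ℝ≥0) {μ : ℝ} (hμ : 0 ≤ μ)
    (hμ' : μ * ∑' n : ℤ, bracket n ^ (2 * (α - 1)) ≤ 1 / 10000) :
    Integrable (fun ω => Real.exp (μ * ‖Φ t ω‖ ^ 2)) P ∧
      ∫ ω, Real.exp (μ * ‖Φ t ω‖ ^ 2) ∂P
        ≤ 10 * Real.exp (2042 * |γ| ^ 2) * Real.exp (contraction t * (μ * ‖u₀‖ ^ 2)) := by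
  have hmeas : AEStronglyMeasurable (fun ω => Real.exp (μ * ‖Φ t ω‖ ^ 2)) P :=
    (by fun_prop : Continuous fun x : PhaseSpace α =>
      Real.exp (μ * ‖x‖ ^ 2)).comp_aestronglyMeasurable (hΦ.measurable t)
  have hle : ∫⁻ ω, ENNReal.ofReal (Real.exp (μ * ‖Φ t ω‖ ^ 2)) ∂P ≤ ENNReal.ofReal
      (10 * Real.exp (2042 * |γ| ^ 2) * Real.exp (contraction t * (μ * ‖u₀‖ ^ 2))) := by
    have hsplit : ∀ ω, ENNReal.ofReal (Real.exp (μ * ‖Φ t ω‖ ^ 2))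
        = ENNReal.ofReal (Real.exp (μ * (‖Φ t ω‖ ^ 2 - contraction t * ‖u₀‖ ^ 2)))
          * ENNReal.ofReal (Real.exp (contraction t * (μ * ‖u₀‖ ^ 2))) := by
      intro ω
      rw [← ENNReal.ofReal_mul (Real.exp_pos _).le, ← Real.exp_add]
      congr 2
      ring
    simp_rw [hsplit]
    rw [lintegral_mul_const' _ _ ENNReal.ofReal_ne_top, ENNReal.ofReal_mul (by positivity)]
    exact mul_le_mul_left (lintegral_exp_norm_sq_sub_le hα hα' hW hΦ t hμ hμ') _
  have hnn : 0 ≤ᵐ[P] fun ω => Real.exp (μ * ‖Φ t ω‖ ^ 2) := ae_of_all _ fun _ => (Real.exp_pos _).le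
  refine ⟨(lintegral_ofReal_ne_top_iff_integrable hmeas hnn).1
    (hle.trans_lt ENNReal.ofReal_lt_top).ne, ?_⟩
  rw [integral_eq_lintegral_of_nonneg_ae hnn hmeas]
  exact ENNReal.toReal_le_of_le_ofReal (by positivity) hle

end Moments

/-! ### Absorbing the contraction factor, and the theorem. -/

/-- A contracted exponential is bounded by a decaying multiple of the exponential, uniformly. -/
lemma exp_contraction_mul_le {t x : ℝ} (hx : 0 ≤ x) :
    Real.exp (contraction t * x) ≤ Real.exp 5 * Real.exp (-1 * t) * Real.exp x + Real.exp 80 := by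
  have h80 := Real.exp_pos 80
  rw [contraction]
  split_ifs with h5
  · rw [one_mul, ← Real.exp_add]
    have : 1 ≤ Real.exp (5 + -1 * t) := Real.one_le_exp (by linarith)
    nlinarith [Real.exp_pos x]
  · push Not at h5
    have he : t * Real.exp (-t) ≤ 1 := by
      have h1 := Real.add_one_le_exp t
      rw [Real.exp_neg, ← div_eq_mul_inv, div_le_one (Real.exp_pos _)]
      linarith
    have hhalf : 40 * Real.exp (-t) ≤ 1 / 2 := by
      have h1 : (80 : ℝ) ≤ Real.exp 5 := by
        have h2 : (2.7 : ℝ) ^ 5 ≤ Real.exp 1 ^ 5 :=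
          pow_le_pow_left₀ (by norm_num) (by linarith [Real.exp_one_gt_d9]) 5
        rw [← Real.exp_nat_mul] at h2
        norm_num at h2
        linarith
      have h3 : Real.exp 5 ≤ Real.exp t := Real.exp_le_exp.2 h5.le
      rw [Real.exp_neg, ← div_eq_mul_inv, div_le_iff₀ (Real.exp_pos _)]
      linarith
    -- If `x ≥ 2t`, halving the exponent saves at least `t`, which yields the factor `exp (-t)`. If
    -- `x ≤ 2t`, the exponent is at most `80 t exp (-t) ≤ 80`.
    rcases le_total (2 * t) x with h | h
    · have h1 : Real.exp (40 * Real.exp (-t) * x) ≤ Real.exp (5 + -1 * t + x) := by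
        rw [Real.exp_le_exp]
        nlinarith [mul_le_mul_of_nonneg_right hhalf hx]
      rw [Real.exp_add, Real.exp_add] at h1
      linarith
    · have h1 : Real.exp (40 * Real.exp (-t) * x) ≤ Real.exp 80 := by
        rw [Real.exp_le_exp]
        nlinarith [mul_le_mul_of_nonneg_left h (Real.exp_pos (-t)).le]
      have : 0 ≤ Real.exp 5 * Real.exp (-1 * t) * Real.exp x := by positivity
      linarith

end SineGordon

theorem lemma3p4 (γ β ε : ℝ) (hγ : γ ≠ 0) (hβ : β ≠ 0) (hε : 0 < ε) (hε' : ε < 1 / 2) :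
    ∃ lam₀ κ C K : ℝ, 0 < lam₀ ∧ 0 < κ ∧ 0 < C ∧ 0 < K ∧
      ∀ lam : ℝ, 0 < lam → lam ≤ lam₀ →
      ∀ (Ω : Type*) [MeasurableSpace Ω] (P : Measure Ω) [IsProbabilityMeasure P]
        (W : ℤ → ℝ≥0 → Ω → ℝ), SineGordon.IsCylindricalWiener P W →
      ∀ (u₀ : SineGordon.PhaseSpace (1 / 2 - ε))
        (Φ : ℝ≥0 → Ω → SineGordon.PhaseSpace (1 / 2 - ε)),
        SineGordon.IsSolution P W γ β u₀ Φ →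
      ∀ t : ℝ≥0,
        Integrable (fun ω => Real.exp (lam * ‖Φ t ω‖ ^ 2)) P ∧
        ∫ ω, Real.exp (lam * ‖Φ t ω‖ ^ 2) ∂P
          ≤ C * Real.exp (-κ * t) * Real.exp (lam * ‖u₀‖ ^ 2) + K := by
  set S := ∑' n : ℤ, SineGordon.bracket n ^ (2 * ((1 / 2 - ε) - 1)) with hS
  have hw : ∀ n : ℤ, 0 < SineGordon.bracket n ^ (2 * ((1 / 2 - ε) - 1)) := fun n =>
    Real.rpow_pos_of_pos (SineGordon.bracket_pos n) _
  have hS0 : 0 < S :=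
    (SineGordon.summable_bracket_rpow (by linarith)).tsum_pos (fun n => (hw n).le) 0 (hw 0)
  have hK := Real.exp_pos (2042 * |γ| ^ 2)
  -- The threshold makes `lam * S ≤ 1 / 10000`; the rate is `1`, and the factors `exp 5` and `exp
  -- 80` come from `exp_contraction_mul_le`.
  refine ⟨1 / 10000 / S, 1, 10 * Real.exp (2042 * |γ| ^ 2) * Real.exp 5,
    10 * Real.exp (2042 * |γ| ^ 2) * Real.exp 80, by positivity, one_pos, by positivity,
    by positivity, ?_⟩
  intro lam hlam hlam₀ Ω _ P _ W hW u₀ Φ hΦ t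
  obtain ⟨hint, hle⟩ := SineGordon.integrable_exp_norm_sq_and_integral_le (by linarith)
    (by linarith) hW hΦ t hlam.le ((le_div_iff₀ hS0).1 hlam₀)
  refine ⟨hint, hle.trans ?_⟩
  have h := mul_le_mul_of_nonneg_left (SineGordon.exp_contraction_mul_le (t := t)
    (by positivity : 0 ≤ lam * ‖u₀‖ ^ 2)) (by positivity : 0 ≤ 10 * Real.exp (2042 * |γ| ^ 2))
  refine h.trans (le_of_eq ?_)
  ring
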